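/- **Setting.** Let $\Sigma$ be a smooth surface with a conformal structure $c$ of signature $(1,1)$ and Hodge star $*$ on one-forms (so $*d\xi=d\xi$, $*d\eta=-d\eta$ in null coordinates $\xi,\eta$). Let $N:(\Sigma,c)\to S^2\subset\mathbb R^3$ be smooth and harmonic, i.e. the tangential component of $d{*dN}$ vanishes. Identify $v\in\mathbb C^3$ with the skew endomorphism $u\mapsto v\times u$, put $\mathcal N=N\times dN$, $\mathcal N^{\pm}=\frac12(\mathcal N\pm *\mathcal N)$, and $$d_\lambda=(d-\mathcal N)+\lambda\,\mathcal N^{+}+\lambda^{-1}\mathcal N^{-}\qquad(\lambda\in\mathbb C^\times)$$ on $\underline{\mathbb C}^3=\Sigma\times\mathbb C^3$; call $d_\lambda$ the connections associated with $N$. Let $\rho^N$ be the (complexified) reflection across $N^\perp$. A gauge transformation $g$ acts on a connection $D$ by $g\cdot D=g\circ D\circ g^{-1}$. Orthogonality and nullity in $\mathbb C^3$ refer to the complex bilinear dot product. For null line subbundles $L,L^*\subset\underline{\mathbb C}^3$ with $L\cap L^*=0$, let $\Gamma^L_{L^*}(\lambda)$ be $\lambda$ on $L$, $1$ on $(L\oplus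 L^*)^\perp$, and $\lambda^{-1}$ on $L^*$. **Lemma.** Let $L,L^*$ be smooth null line subbundles of $\underline{\mathbb C}^3$ with $L\cap L^*=0$, let $\lambda\mapsto D_\lambda=d+A_\lambda$ be any family of metric connections (that is, $A_\lambda$ has values in the endomorphisms that are skew for the dot product), and let $\psi$ be a linear fractional transformation. If $\psi$ has its zero at $\alpha\in\mathbb C$ and $A_\lambda$ is holomorphic in $\lambda$ at $\alpha$, then $\lambda\mapsto\Gamma^L_{L^*}(\psi(\lambda))\cdot D_\lambda$ is (extends to be) holomorphic at $\alpha$ if and only if $L$ is $D_\alpha$-parallel. If $\psi$ has its pole at $\beta\in\mathbb C$ and $A_\lambda$ is holomorphic in $\lambda$ at $\beta$, then it is holomorphic at $\beta$ if and only if $L^*$ is $D_\beta$-parallel. **Theorem.** Let $a>0$ and let $L\subset\underline{\mathbb C}^3$ be a smooth null line subbundle that is $d_{ia}$-parallel, with $\rho^NL=\overline L=:L^*$ and $L\cap L^*=0$. Put $$r(\lambda)=\Gamma^L_{L^*}\!\left(\frac{1+ia}{1-ia}\cdot\frac{\lambda-ia}{\lambda+ia}\right),\qquad r(\infty)=\Gamma^L_{L^*}\!\left(\frac{1+ia}{1-ia}\right).$$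 1. $\hat N:=r(\infty)N$ is a real unit vector field and $\hat N:(\Sigma,c)\to S^2$ is smooth and harmonic. Its associated connections $\hat d_\lambda$ are flat for all $\lambda\in\mathbb C^\times$, and $\hat d_\lambda=r(\lambda)\cdot d_\lambda$ for all $\lambda\in\mathbb C^\times\setminus\{\pm ia\}$; the family $r(\lambda)\cdot d_\lambda$ extends holomorphically across $\lambda=\pm ia$. 2. Let $W\subset\Sigma$ be open and let $f:W\to\mathbb R^3$ be smooth with $df=N\times *dN$. Then $\partial r/\partial\lambda|_{\lambda=1}$ takes values in the real skew endomorphisms, so is a map to $\mathbb R^3$, and $\hat f:=f-\partial r/\partial\lambda|_{\lambda=1}$ is smooth with $d\hat f=\hat N\times *d\hat N$. At every point of $W$: - wherever $f$ (respectively $\hat f$) immerses, it has unit normal $N$ (respectively $\hat N$) and Gauss curvature $-1$, and its second fundamental form is a non-zero multiple of (a representative metric of) $c$; - $\hat f$ is a Bäcklund transform $f_a$ of $f$: $\hat f-f$ is orthogonal to $N$ and to $\hat N$, lies in the tangent plane of $f$ (of $\hat f$) wherever $f$ ($\hat f$) immerses, $$|\hat f-f|=\frac{2}{a+a^{-1}},\qquad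 \hat N\cdot N=\frac{a^{-1}-a}{a^{-1}+a},$$ and $\hat f-f$ lies on the line $(L\oplus L^*)^\perp$; - wherever both $f$ and $\hat f$ immerse, they have the same asymptotic directions. -/

import Mathlib

open scoped Manifold ContDiff Topology Matrix

/-- The model plane of a smooth surface. -/
abbrev Plane : Type := EuclideanSpace ℝ (Fin 2)

/-- Euclidean three-space. -/
abbrev R3 : Type := EuclideanSpace ℝ (Fin 3)

/-- `ℂ³`, with its complex bilinear dot product `u ⬝ᵥ v`. -/
abbrev C3 : Type := Fin 3 → ℂ

/-- Endomorphisms of `ℂ³`. -/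
abbrev EndC3 : Type := C3 →L[ℂ] C3

/-! ### Vector algebra -/

/-- The cross product of `ℝ³`. -/
noncomputable def cross (u v : R3) : R3 := WithLp.toLp 2 (crossProduct u.ofLp v.ofLp)

/-- The inclusion `ℝ³ ⊆ ℂ³`. -/
noncomputable def cx (v : R3) : C3 := fun i => (v i : ℂ)

/-- The identification of vectors with skew endomorphisms, `w ↦ (u ↦ w × u)`. -/
noncomputable def crossEnd (w : C3) : EndC3 := LinearMap.toContinuousLinearMap (crossProduct w)

/-- For `n ∈ ℝ³`, the real-linear map `v ↦ (u ↦ (n × v) × u)` into the endomorphisms of `ℂ³`. -/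
noncomputable def crossCrossEnd (n : R3) : R3 →L[ℝ] EndC3 :=
  LinearMap.toContinuousLinearMap
    { toFun := fun v => crossEnd (cx (cross n v))
      map_add' := by
        intro x y
        ext u i
        fin_cases i <;> simp [crossEnd, cx, cross, crossProduct] <;> ring
      map_smul' := by
        intro k x
        ext u i
        fin_cases i <;> simp [crossEnd, cx, cross, crossProduct] <;> ring }

/-- The complex-linear reflection across the plane orthogonal to the unit vector `n ∈ ℝ³`. -/
noncomputable def reflC (n : R3) : C3 →ₗ[ℂ] C3 where
  toFun v := v - (2 * (v ⬝ᵥ cx n)) • cx n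
  map_add' := by
    intro x y
    rw [add_dotProduct, mul_add, add_smul]
    abel
  map_smul' := by
    intro k x
    rw [smul_dotProduct, RingHom.id_apply, smul_sub, smul_smul, smul_eq_mul]
    ring_nf

/-- The complex conjugate of a subspace of `ℂ³`. -/
def conjLine (l : Submodule ℂ C3) : Submodule ℂ C3 where
  carrier := {v | star v ∈ l}
  add_mem' := by
    intro x y hx hy
    simpa using l.add_mem hx hy
  zero_mem' := by simp
  smul_mem' := by
    intro k x hx
    simpa using l.smul_mem (star k) hx

/-- `g` is `z` on `l`, is `1` on `(l ⊕ m)^⊥`, and is `z⁻¹` on `m`. -/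
def IsGamma (l m : Submodule ℂ C3) (z : ℂ) (g : EndC3) : Prop :=
  (∀ u ∈ l, g u = z • u) ∧
  (∀ u : C3, (∀ v ∈ l ⊔ m, u ⬝ᵥ v = 0) → g u = u) ∧
  (∀ u ∈ m, g u = z⁻¹ • u)

open Classical in
/-- The endomorphism `Γ^l_m(z)`: it is `z` on `l`, is `1` on `(l ⊕ m)^⊥`, and is `z⁻¹` on `m`.
It exists and is unique if `l ≠ m` are null lines, see `gamma_spec` and `IsGamma.unique`. -/
noncomputable def gamma (l m : Submodule ℂ C3) (z : ℂ) : EndC3 :=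
  if h : ∃ g, IsGamma l m z g then h.choose else 1

/-- Two independent null vectors of `ℂ³` are not orthogonal. -/
theorem dot_ne_zero_of_null {u w : C3} (hu : u ⬝ᵥ u = 0) (hw : w ⬝ᵥ w = 0)
    (h : LinearIndependent ℂ ![u, w]) : u ⬝ᵥ w ≠ 0 := by
  intro huw
  have hwu : w ⬝ᵥ u = 0 := by rw [dotProduct_comm]; exact huw
  have hx : crossProduct u w ≠ 0 := crossProduct_ne_zero_iff_linearIndependent.2 h
  have h1 : crossProduct (crossProduct u w) u = 0 := by
    rw [cross_cross_eq_smul_sub_smul]; simp [hu, hwu]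
  have h2 : crossProduct (crossProduct u w) w = 0 := by
    rw [cross_cross_eq_smul_sub_smul]; simp [huw, hw]
  have key : ∀ v : C3, crossProduct (crossProduct u w) v = 0 →
      ∃ k : ℂ, v = k • crossProduct u w := by
    intro v hv
    have := mt crossProduct_ne_zero_iff_linearIndependent.2 (not_not.2 hv)
    rw [LinearIndependent.pair_iff' hx] at this
    push Not at this
    obtain ⟨k, hk⟩ := this
    exact ⟨k, hk.symm⟩
  obtain ⟨k, hk⟩ := key u h1
  obtain ⟨m, hm⟩ := key w h2
  apply hx
  have h3 : crossProduct u w =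
      crossProduct (k • crossProduct u w) (m • crossProduct u w) := by rw [← hk, ← hm]
  rw [h3]
  simp only [map_smul, LinearMap.smul_apply, cross_self, smul_zero]

/-- `Γ^l_m(z)` is as described if `l` and `m` are distinct null lines. -/
theorem gamma_spec {u w : C3} (hu : u ⬝ᵥ u = 0) (hw : w ⬝ᵥ w = 0)
    (h : LinearIndependent ℂ ![u, w]) (z : ℂ) :
    IsGamma (Submodule.span ℂ {u}) (Submodule.span ℂ {w}) z
      (gamma (Submodule.span ℂ {u}) (Submodule.span ℂ {w}) z) := by
  have huw := dot_ne_zero_of_null hu hw h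
  have hex : ∃ g, IsGamma (Submodule.span ℂ {u}) (Submodule.span ℂ {w}) z g := by
    let g : C3 →ₗ[ℂ] C3 :=
      { toFun := fun v => v + ((z - 1) * (v ⬝ᵥ w) / (u ⬝ᵥ w)) • u
          + ((z⁻¹ - 1) * (v ⬝ᵥ u) / (u ⬝ᵥ w)) • w
        map_add' := by
          intro x y
          simp only [add_dotProduct]
          module
        map_smul' := by
          intro k x
          simp only [smul_dotProduct, smul_eq_mul, RingHom.id_apply]
          module }
    have hg : ∀ v, LinearMap.toContinuousLinearMap g v = v + ((z - 1) * (v ⬝ᵥ w) / (u ⬝ᵥ w)) • u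
          + ((z⁻¹ - 1) * (v ⬝ᵥ u) / (u ⬝ᵥ w)) • w := fun v => rfl
    have hwu : w ⬝ᵥ u = u ⬝ᵥ w := dotProduct_comm w u
    refine ⟨LinearMap.toContinuousLinearMap g, ?_, ?_, ?_⟩
    · intro v hv
      obtain ⟨k, rfl⟩ := Submodule.mem_span_singleton.1 hv
      rw [hg]
      simp only [smul_dotProduct, smul_eq_mul, hu, mul_zero, zero_div, zero_smul, add_zero]
      rw [show (z - 1) * (k * u ⬝ᵥ w) / u ⬝ᵥ w = (z - 1) * k by field_simp]
      module
    · intro v hv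
      rw [hg, hv u (Submodule.mem_sup_left (Submodule.mem_span_singleton_self u)),
        hv w (Submodule.mem_sup_right (Submodule.mem_span_singleton_self w))]
      simp
    · intro v hv
      obtain ⟨k, rfl⟩ := Submodule.mem_span_singleton.1 hv
      rw [hg]
      simp only [smul_dotProduct, smul_eq_mul, hw, hwu, mul_zero, zero_div, zero_smul, add_zero]
      rw [show (z⁻¹ - 1) * (k * u ⬝ᵥ w) / u ⬝ᵥ w = (z⁻¹ - 1) * k by field_simp]
      module
  unfold gamma
  rw [dif_pos hex]
  exact hex.choose_spec

/-- The endomorphism `Γ^l_m(z)` is unique if `l` and `m` are distinct null lines. -/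
theorem IsGamma.unique {u w : C3} (hu : u ⬝ᵥ u = 0) (hw : w ⬝ᵥ w = 0)
    (h : LinearIndependent ℂ ![u, w]) {z : ℂ} {g g' : EndC3}
    (hg : IsGamma (Submodule.span ℂ {u}) (Submodule.span ℂ {w}) z g)
    (hg' : IsGamma (Submodule.span ℂ {u}) (Submodule.span ℂ {w}) z g') : g = g' := by
  have huw := dot_ne_zero_of_null hu hw h
  have hwu : w ⬝ᵥ u = u ⬝ᵥ w := dotProduct_comm w u
  have mu : u ∈ Submodule.span ℂ {u} := Submodule.mem_span_singleton_self u
  have mw : w ∈ Submodule.span ℂ {w} := Submodule.mem_span_singleton_self w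
  ext1 v
  have hv : v = (v ⬝ᵥ w / u ⬝ᵥ w) • u + (v ⬝ᵥ u / u ⬝ᵥ w) • w +
      (v - (v ⬝ᵥ w / u ⬝ᵥ w) • u - (v ⬝ᵥ u / u ⬝ᵥ w) • w) := by abel
  have hp : ∀ y ∈ Submodule.span ℂ {u} ⊔ Submodule.span ℂ {w},
      (v - (v ⬝ᵥ w / u ⬝ᵥ w) • u - (v ⬝ᵥ u / u ⬝ᵥ w) • w) ⬝ᵥ y = 0 := by
    intro y hy
    obtain ⟨y₁, h₁, y₂, h₂, rfl⟩ := Submodule.mem_sup.1 hy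
    obtain ⟨k, rfl⟩ := Submodule.mem_span_singleton.1 h₁
    obtain ⟨m, rfl⟩ := Submodule.mem_span_singleton.1 h₂
    simp only [sub_dotProduct, smul_dotProduct, dotProduct_add, dotProduct_smul, smul_eq_mul,
      hu, hw, hwu]
    field_simp
    ring
  rw [hv]
  simp only [map_add, map_smul, hg.1 u mu, hg'.1 u mu, hg.2.2 w mw, hg'.2.2 w mw]
  rw [hg.2.1 _ hp, hg'.2.1 _ hp]

/-! ### Calculus on a surface -/

section Surface

variable {M : Type*} [TopologicalSpace M] [ChartedSpace Plane M]
variable {F : Type*} [NormedAddCommGroup F] [NormedSpace ℝ F]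

/-- The differential of a map from the surface to a vector space. -/
noncomputable def dmap (f : M → F) (p : M) : TangentSpace 𝓘(ℝ, Plane) p →L[ℝ] F :=
  mfderiv 𝓘(ℝ, Plane) 𝓘(ℝ, F) f p

/-- The coordinate frame of the chart at `p₀`, at the point with coordinates `x`. -/
noncomputable def chartFrame (p₀ : M) (x : Plane) :
    Plane →L[ℝ] TangentSpace 𝓘(ℝ, Plane) ((extChartAt 𝓘(ℝ, Plane) p₀).symm x) :=
  mfderiv 𝓘(ℝ, Plane) 𝓘(ℝ, Plane) (extChartAt 𝓘(ℝ, Plane) p₀).symm x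

/-- The exterior derivative `dθ(X, Y)` at `p` of a vector-valued one-form, computed in the chart
at `p` (in which Mathlib identifies the tangent space at `p` with the model plane). -/
noncomputable def extD (θ : ∀ p : M, TangentSpace 𝓘(ℝ, Plane) p →L[ℝ] F) (p : M)
    (X Y : TangentSpace 𝓘(ℝ, Plane) p) : F :=
  let form : Plane → Plane →L[ℝ] F :=
    fun x => (θ ((extChartAt 𝓘(ℝ, Plane) p).symm x)).comp (chartFrame p x)
  fderiv ℝ form (extChartAt 𝓘(ℝ, Plane) p p) X Y - fderiv ℝ form (extChartAt 𝓘(ℝ, Plane) p p) Y X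

/-! ### Connections on the trivial bundle with fibre `ℂ³` -/

variable (M) in
/-- `End(ℂ³)`-valued one-forms `A`; the form `A` stands for the connection `d + A`. -/
abbrev ConnForm : Type _ := ∀ p : M, TangentSpace 𝓘(ℝ, Plane) p →L[ℝ] EndC3

variable (M) in
/-- First-order operators on sections of the trivial bundle: `D s p X` stands for `(D_X s)(p)`. -/
abbrev SectionOp : Type _ := (M → C3) → ∀ p : M, TangentSpace 𝓘(ℝ, Plane) p → C3

/-- The covariant derivative of the connection `d + A`. -/
noncomputable def covD (A : ConnForm M) : SectionOp M := fun s p X => dmap s p X + A p X (s p)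

/-- The connection `d + A` is flat: `dA + A ∧ A = 0`. -/
def IsFlat (A : ConnForm M) : Prop :=
  ∀ (p : M) (X Y : TangentSpace 𝓘(ℝ, Plane) p),
    extD A p X Y + (A p X * A p Y - A p Y * A p X) = 0

/-- The connection `d + A` is metric: it preserves the complex bilinear dot product. -/
def IsMetricConn (A : ConnForm M) : Prop :=
  ∀ (p : M) (X : TangentSpace 𝓘(ℝ, Plane) p) (u v : C3), A p X u ⬝ᵥ v + u ⬝ᵥ A p X v = 0

/-- The action `g · D = g ∘ D ∘ g⁻¹` of gauge transformations. -/
noncomputable def gaugeAct (g : M → EndC3) (D : SectionOp M) : SectionOp M :=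
  fun s p X => g p (D (fun q => (g q).inverse (s q)) p X)

/-- The family of connections `z ↦ D z`, given near `α` except perhaps at `α` itself, is (after
removal of the singularity) holomorphic at `α`. -/
def HolomorphicAcross (D : ℂ → SectionOp M) (α : ℂ) : Prop :=
  ∀ (s : M → C3) (p : M), ContMDiffAt 𝓘(ℝ, Plane) 𝓘(ℝ, C3) ∞ s p →
    ∀ X : TangentSpace 𝓘(ℝ, Plane) p,
      ∃ h : ℂ → C3, AnalyticAt ℂ h α ∧ (fun z => D z s p X) =ᶠ[𝓝[≠] α] h

/-- `L` is a smooth null line subbundle of the trivial bundle with fibre `ℂ³`. -/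
structure IsNullLineSubbundle (L : M → Submodule ℂ C3) : Prop where
  null : ∀ p, ∀ u ∈ L p, u ⬝ᵥ u = 0
  smooth : ∀ p, ∃ U ∈ 𝓝 p, ∃ s : M → C3, ContMDiffOn 𝓘(ℝ, Plane) 𝓘(ℝ, C3) ∞ s U ∧
    ∀ q ∈ U, s q ≠ 0 ∧ L q = Submodule.span ℂ {s q}

/-- `L` is `D`-parallel: covariant derivatives of local smooth sections of `L` lie in `L`. -/
def IsParallel (D : SectionOp M) (L : M → Submodule ℂ C3) : Prop :=
  ∀ (s : M → C3) (p : M), ContMDiffAt 𝓘(ℝ, Plane) 𝓘(ℝ, C3) ∞ s p →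
    (∀ᶠ q in 𝓝 p, s q ∈ L q) → ∀ X : TangentSpace 𝓘(ℝ, Plane) p, D s p X ∈ L p

/-! ### Conformal structures of signature `(1,1)`, harmonic maps to the sphere -/

variable (M) in
/-- A conformal structure of signature `(1,1)`, given by a representative smooth metric, together
with its Hodge star. The latter is recorded by the endomorphism `J` of the tangent bundle with
`*θ = θ ∘ J`; the two conditions on `J` say that `g(J ·, ·)` is the area form of an orientation.
In null coordinates, `J ∂_ξ = ∂_ξ` and `J ∂_η = -∂_η` (in the appropriate order). -/
structure LorentzConformalStructure where
  metric : ∀ p : M, TangentSpace 𝓘(ℝ, Plane) p →L[ℝ] TangentSpace 𝓘(ℝ, Plane) p →L[ℝ] ℝ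
  symm : ∀ p X Y, metric p X Y = metric p Y X
  exists_pos : ∀ p, ∃ X, 0 < metric p X X
  exists_neg : ∀ p, ∃ X, metric p X X < 0
  smooth_metric : ∀ (p₀ : M) (u v : Plane),
    ContDiffOn ℝ ∞
      (fun x => metric ((extChartAt 𝓘(ℝ, Plane) p₀).symm x) (chartFrame p₀ x u)
        (chartFrame p₀ x v))
      (extChartAt 𝓘(ℝ, Plane) p₀).target
  hodge : ∀ p : M, TangentSpace 𝓘(ℝ, Plane) p →L[ℝ] TangentSpace 𝓘(ℝ, Plane) p
  hodge_hodge : ∀ p X, hodge p (hodge p X) = X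
  metric_hodge : ∀ p X Y, metric p (hodge p X) Y = - metric p X (hodge p Y)
  smooth_hodge : ∀ (p₀ : M) (u : Plane),
    ContDiffOn ℝ ∞
      (fun x => dmap (extChartAt 𝓘(ℝ, Plane) p₀) ((extChartAt 𝓘(ℝ, Plane) p₀).symm x)
        (hodge ((extChartAt 𝓘(ℝ, Plane) p₀).symm x) (chartFrame p₀ x u)))
      (extChartAt 𝓘(ℝ, Plane) p₀).target

/-- The Hodge star on one-forms. -/
noncomputable def hodgeStar (c : LorentzConformalStructure M)
    (θ : ∀ p : M, TangentSpace 𝓘(ℝ, Plane) p →L[ℝ] F) (p : M) :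
    TangentSpace 𝓘(ℝ, Plane) p →L[ℝ] F :=
  (θ p).comp (c.hodge p)

/-- `N : (M, c) → S²` is a smooth harmonic map: the component of `d * dN` tangent to the sphere
vanishes. -/
structure IsHarmonic (c : LorentzConformalStructure M) (N : M → R3) : Prop where
  smooth : ContMDiff 𝓘(ℝ, Plane) 𝓘(ℝ, R3) ∞ N
  unit : ∀ p, ‖N p‖ = 1
  tension : ∀ (p : M) (X Y : TangentSpace 𝓘(ℝ, Plane) p),
    cross (N p) (extD (hodgeStar c (dmap N)) p X Y) = 0

/-- The `so(3)`-valued one-form `N × dN`. If `|N| = 1`, this is the part of `d` which anti-commutes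
with the reflection across the plane orthogonal to `N`. -/
noncomputable def offDiag (N : M → R3) : ConnForm M :=
  fun p => (crossCrossEnd (N p)).comp (dmap N p)

/-- The part of `offDiag N` on which the Hodge star is `1`. -/
noncomputable def offDiagPlus (c : LorentzConformalStructure M) (N : M → R3) : ConnForm M :=
  fun p => (1 / 2 : ℂ) • (offDiag N p + hodgeStar c (offDiag N) p)

/-- The part of `offDiag N` on which the Hodge star is `-1`. -/
noncomputable def offDiagMinus (c : LorentzConformalStructure M) (N : M → R3) : ConnForm M :=
  fun p => (1 / 2 : ℂ) • (offDiag N p - hodgeStar c (offDiag N) p)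

/-- The connections associated with `N`: the off-diagonal part `n` of `d` is replaced by
`z n⁺ + z⁻¹ n⁻`. -/
noncomputable def assocForm (c : LorentzConformalStructure M) (N : M → R3) (z : ℂ) : ConnForm M :=
  fun p => - offDiag N p + z • offDiagPlus c N p + z⁻¹ • offDiagMinus c N p

/-! ### The dressing transformation -/

/-- `r(z) = Γ^L_{L*}( ((1 + ia)/(1 - ia)) ((z - ia)/(z + ia)) )`, where `L*` is the complex
conjugate of `L`. -/
noncomputable def dressing (L : M → Submodule ℂ C3) (a : ℝ) (z : ℂ) (p : M) : EndC3 :=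
  gamma (L p) (conjLine (L p))
    ((1 + Complex.I * a) / (1 - Complex.I * a) * ((z - Complex.I * a) / (z + Complex.I * a)))

/-- `r(∞)`. -/
noncomputable def dressingInfty (L : M → Submodule ℂ C3) (a : ℝ) (p : M) : EndC3 :=
  gamma (L p) (conjLine (L p)) ((1 + Complex.I * a) / (1 - Complex.I * a))

/-! ### Surfaces in space -/

/-- `df = N × *dN` at `p`. -/
def IsPotentialAt (c : LorentzConformalStructure M) (N f : M → R3) (p : M) : Prop :=
  ∀ X : TangentSpace 𝓘(ℝ, Plane) p, dmap f p X = cross (N p) (hodgeStar c (dmap N) p X)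

/-- The second fundamental form `-df · dN`. -/
noncomputable def secondForm (f N : M → R3) (p : M) (X Y : TangentSpace 𝓘(ℝ, Plane) p) : ℝ :=
  - inner ℝ (dmap f p X) (dmap N p Y)

/-- `f` immerses at `p`. -/
def ImmersesAt (f : M → R3) (p : M) : Prop := Function.Injective (dmap f p)

/-- At `p`, the map `f` is an immersion with unit normal `N` and with Gauss curvature `K`, the
determinant of the shape operator `S = -(df)⁻¹ ∘ dN`. -/
structure HasGaussMapAndCurvatureAt (f N : M → R3) (p : M) (K : ℝ) : Prop where
  immerses : ImmersesAt f p
  unit : ‖N p‖ = 1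
  normal : ∀ X : TangentSpace 𝓘(ℝ, Plane) p, inner ℝ (N p) (dmap f p X) = 0
  curvature : ∃ S : TangentSpace 𝓘(ℝ, Plane) p →ₗ[ℝ] TangentSpace 𝓘(ℝ, Plane) p,
    (∀ X, dmap f p (S X) = - dmap N p X) ∧ LinearMap.det S = K

/-- At `p`, the conformal structure `c` is the one spanned by the second fundamental form. -/
def SecondFormSpansAt (c : LorentzConformalStructure M) (f N : M → R3) (p : M) : Prop :=
  ∃ k : ℝ, k ≠ 0 ∧ ∀ X Y : TangentSpace 𝓘(ℝ, Plane) p, secondForm f N p X Y = k * c.metric p X Y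

/-- The Bäcklund relation with parameter `a` at `p`, for surfaces `f`, `f'` of Gauss curvature `-1`
with unit normals `N`, `N'`: the segment from `f` to `f'` is tangent to both surfaces (orthogonal to
both normals, and in the image of the differential wherever this is a plane) and has length
`2 / (a + a⁻¹)`, and `N' · N = (a⁻¹ - a) / (a⁻¹ + a)`. -/
structure IsBacklundAt (a : ℝ) (f N f' N' : M → R3) (p : M) : Prop where
  orthogonal : inner ℝ (N p) (f' p - f p) = 0
  orthogonal' : inner ℝ (N' p) (f' p - f p) = 0
  tangent : ImmersesAt f p → ∃ X, dmap f p X = f' p - f p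
  tangent' : ImmersesAt f' p → ∃ X, dmap f' p X = f' p - f p
  distance : dist (f' p) (f p) = 2 / (a + a⁻¹)
  angle : inner ℝ (N' p) (N p) = (a⁻¹ - a) / (a⁻¹ + a)

end Surface

/-!
Near a zero of `ψ` the gauged family `Γ(ψ) · D` is holomorphic up to `ψ⁻¹` times the second
fundamental form of `L` with respect to `D`, which vanishes at the zero if and only if `L` is
parallel there; a pole of `ψ` is a zero of `ψ⁻¹`, which exchanges the two lines.

Since `L` is reflected to its conjugate across the complement of `n = N`, it is spanned by
`n + i t` for a unit field `t` orthogonal to `n`, and so `n` belongs to an orthonormal frame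
`n, t, w`. Let `Ω` be its angular velocity, and compare `d_λ` with the connection that annihilates
the frame: the difference is the cross product with a spectral velocity that is affine in `λ` and
`λ⁻¹`. That `L` is `d_{ia}`-parallel is the equation
`2 ⟨n, Ω⟩ = (a - a⁻¹) ⟨t, Ω⟩ + (a + a⁻¹) ⟨t, *Ω⟩`. It says that, when `n` and `t` are rotated by the
Bäcklund angle `θ`, the null components of the spectral velocity are multiplied by the eigenvalues
of `r(λ)`, hence that `r(λ)` gauges `d_λ` to the connections associated with the rotated normal
`n'`. It also gives `n' × *dn' = n × *dn + sin θ dw`, so that `n'` is harmonic, and it is the normal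
of `f + (sin θ) w` whenever `df = n × *dn`. The second fundamental form of such a surface `f` is
`-⟨n, dn(*X) × dn(Y)⟩`, an alternating form composed with `*`, hence a multiple of `c`; its shape
operator `S` satisfies `dn ∘ * ∘ S = n × dn`, a quarter turn of `dn`, and since `*` has determinant
`-1`, so does `S`.
-/

/-! ### Calculus of vector-valued functions and one-forms on a surface -/

section Calculus

variable {M : Type*} [TopologicalSpace M] [ChartedSpace Plane M]
variable {E F G : Type*} [NormedAddCommGroup E] [NormedSpace ℝ E]
  [NormedAddCommGroup F] [NormedSpace ℝ F] [NormedAddCommGroup G] [NormedSpace ℝ G]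
variable {p : M}

/-- The expression of a vector-valued map in the chart at `p`. -/
noncomputable def chartRep (f : M → F) (p : M) : Plane → F :=
  f ∘ (extChartAt 𝓘(ℝ, Plane) p).symm

/-- The coordinates of `p` in the chart at `p`. -/
noncomputable abbrev chartPt (p : M) : Plane := extChartAt 𝓘(ℝ, Plane) p p

theorem chartRep_chartPt {V : Type*} (f : M → V) (p : M) : chartRep f p (chartPt p) = f p := by
  simp [chartRep, chartPt]

/-- The differential of a vector-valued map at `p`, as a linear map on the model plane, with which
Mathlib identifies the tangent space at `p` by means of the chart at `p`. -/
noncomputable def dmapRep (f : M → F) (p : M) : Plane →L[ℝ] F := dmap f p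

theorem hasFDerivAt_chartRep {f : M → F}
    (hf : MDifferentiableAt 𝓘(ℝ, Plane) 𝓘(ℝ, F) f p) :
    HasFDerivAt (chartRep f p) (dmapRep f p) (chartPt p) := by
  have h := hf.hasMFDerivAt.2
  rw [modelWithCornersSelf_coe, Set.range_id] at h
  exact hasFDerivWithinAt_univ.1 h

theorem contDiffAt_chartRep {f : M → F} (hf : ContMDiffAt 𝓘(ℝ, Plane) 𝓘(ℝ, F) ∞ f p) :
    ContDiffAt ℝ ∞ (chartRep f p) (chartPt p) := by
  have h := (contMDiffAt_iff.1 hf).2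
  simpa [chartRep, contDiffWithinAt_univ, Function.comp_def] using! h

theorem dmap_eq_of_hasFDerivAt {f : M → F}
    (hf : MDifferentiableAt 𝓘(ℝ, Plane) 𝓘(ℝ, F) f p) {f' : Plane →L[ℝ] F}
    (h : HasFDerivAt (chartRep f p) f' (chartPt p)) : dmap f p = f' :=
  (hasFDerivAt_chartRep hf).unique h

theorem dmap_congr {f g : M → F} (h : f =ᶠ[𝓝 p] g) : dmap f p = dmap g p :=
  h.mfderiv_eq

theorem dmap_const (v : F) (p : M) : dmap (fun _ : M => v) p = 0 :=
  dmap_eq_of_hasFDerivAt mdifferentiableAt_const (hasFDerivAt_const v _)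

theorem dmap_add {f g : M → F}
    (hf : MDifferentiableAt 𝓘(ℝ, Plane) 𝓘(ℝ, F) f p)
    (hg : MDifferentiableAt 𝓘(ℝ, Plane) 𝓘(ℝ, F) g p) :
    dmap (fun q => f q + g q) p = dmap f p + dmap g p :=
  dmap_eq_of_hasFDerivAt (hf.add hg) ((hasFDerivAt_chartRep hf).add (hasFDerivAt_chartRep hg))

theorem contMDiffAt_clm (B : F →L[ℝ] G) {f : M → F}
    (hf : ContMDiffAt 𝓘(ℝ, Plane) 𝓘(ℝ, F) ∞ f p) :
    ContMDiffAt 𝓘(ℝ, Plane) 𝓘(ℝ, G) ∞ (fun q => B (f q)) p :=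
  B.contDiff.contDiffAt.contMDiffAt.comp p hf

theorem mdifferentiableAt_clm (B : F →L[ℝ] G) {f : M → F}
    (hf : MDifferentiableAt 𝓘(ℝ, Plane) 𝓘(ℝ, F) f p) :
    MDifferentiableAt 𝓘(ℝ, Plane) 𝓘(ℝ, G) (fun q => B (f q)) p :=
  B.differentiableAt.mdifferentiableAt.comp p hf

theorem dmap_clm (B : F →L[ℝ] G) {f : M → F}
    (hf : MDifferentiableAt 𝓘(ℝ, Plane) 𝓘(ℝ, F) f p) (X : TangentSpace 𝓘(ℝ, Plane) p) :
    dmap (fun q => B (f q)) p X = B (dmap f p X) := by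
  rw [dmap_eq_of_hasFDerivAt (mdifferentiableAt_clm B hf)
    (B.hasFDerivAt.comp _ (hasFDerivAt_chartRep hf))]
  rfl

theorem contMDiffAt_bilin (B : E →L[ℝ] F →L[ℝ] G) {f : M → E} {g : M → F}
    (hf : ContMDiffAt 𝓘(ℝ, Plane) 𝓘(ℝ, E) ∞ f p)
    (hg : ContMDiffAt 𝓘(ℝ, Plane) 𝓘(ℝ, F) ∞ g p) :
    ContMDiffAt 𝓘(ℝ, Plane) 𝓘(ℝ, G) ∞ (fun q => B (f q) (g q)) p :=
  (B.isBoundedBilinearMap.contDiff.contDiffAt.contMDiffAt).comp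
    (f := fun q => (f q, g q)) p (hf.prodMk_space hg)

theorem mdifferentiableAt_bilin (B : E →L[ℝ] F →L[ℝ] G) {f : M → E} {g : M → F}
    (hf : MDifferentiableAt 𝓘(ℝ, Plane) 𝓘(ℝ, E) f p)
    (hg : MDifferentiableAt 𝓘(ℝ, Plane) 𝓘(ℝ, F) g p) :
    MDifferentiableAt 𝓘(ℝ, Plane) 𝓘(ℝ, G) (fun q => B (f q) (g q)) p :=
  ((B.isBoundedBilinearMap.differentiableAt (f p, g p)).mdifferentiableAt).comp
    (f := fun q => (f q, g q)) p (hf.prodMk_space hg)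

theorem dmap_bilin (B : E →L[ℝ] F →L[ℝ] G) {f : M → E} {g : M → F}
    (hf : MDifferentiableAt 𝓘(ℝ, Plane) 𝓘(ℝ, E) f p)
    (hg : MDifferentiableAt 𝓘(ℝ, Plane) 𝓘(ℝ, F) g p) (X : TangentSpace 𝓘(ℝ, Plane) p) :
    dmap (fun q => B (f q) (g q)) p X = B (f p) (dmap g p X) + B (dmap f p X) (g p) := by
  have h := B.hasFDerivAt_of_bilinear (hasFDerivAt_chartRep hf) (hasFDerivAt_chartRep hg)
  rw [dmap_eq_of_hasFDerivAt (mdifferentiableAt_bilin B hf hg) h]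
  simp only [chartRep_chartPt]
  rfl

/-- The expression of a one-form in the chart at `p`. -/
noncomputable def coordForm (θ : ∀ p : M, TangentSpace 𝓘(ℝ, Plane) p →L[ℝ] F) (p : M)
    (x : Plane) : Plane →L[ℝ] F :=
  (θ ((extChartAt 𝓘(ℝ, Plane) p).symm x)).comp (chartFrame p x)

/-- A one-form is differentiable at `p`, that is, its coefficients in the chart at `p` are. -/
def FormDiffAt (θ : ∀ p : M, TangentSpace 𝓘(ℝ, Plane) p →L[ℝ] F) (p : M) : Prop :=
  DifferentiableAt ℝ (coordForm θ p) (chartPt p)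

/-- The product of a vector-valued function and a one-form, with respect to a bilinear map. -/
noncomputable def bilinForm (B : E →L[ℝ] F →L[ℝ] G) (f : M → E)
    (θ : ∀ p : M, TangentSpace 𝓘(ℝ, Plane) p →L[ℝ] F) (p : M) :
    TangentSpace 𝓘(ℝ, Plane) p →L[ℝ] G := (B (f p)).comp (θ p)

theorem extD_eq (θ : ∀ p : M, TangentSpace 𝓘(ℝ, Plane) p →L[ℝ] F) (p : M)
    (X Y : TangentSpace 𝓘(ℝ, Plane) p) :
    extD θ p X Y = fderiv ℝ (coordForm θ p) (chartPt p) X Y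
      - fderiv ℝ (coordForm θ p) (chartPt p) Y X := rfl

theorem extD_add {θ η : ∀ p : M, TangentSpace 𝓘(ℝ, Plane) p →L[ℝ] F}
    (hθ : FormDiffAt θ p) (hη : FormDiffAt η p) (X Y : TangentSpace 𝓘(ℝ, Plane) p) :
    extD (fun q => θ q + η q) p X Y = extD θ p X Y + extD η p X Y := by
  have hsum : coordForm (fun q => θ q + η q) p = coordForm θ p + coordForm η p := rfl
  simp only [extD_eq, hsum]
  rw [fderiv_add hθ hη]
  exact add_sub_add_comm _ _ _ _

theorem FormDiffAt.clm {θ : ∀ p : M, TangentSpace 𝓘(ℝ, Plane) p →L[ℝ] F}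
    (hθ : FormDiffAt θ p) (B : F →L[ℝ] G) : FormDiffAt (fun q => B.comp (θ q)) p :=
  ((ContinuousLinearMap.compL ℝ Plane F G B).hasFDerivAt.comp _
    hθ.hasFDerivAt).differentiableAt

theorem extD_clm {θ : ∀ p : M, TangentSpace 𝓘(ℝ, Plane) p →L[ℝ] F}
    (hθ : FormDiffAt θ p) (B : F →L[ℝ] G) (X Y : TangentSpace 𝓘(ℝ, Plane) p) :
    extD (fun q => B.comp (θ q)) p X Y = B (extD θ p X Y) := by
  have h : HasFDerivAt (coordForm (fun q => B.comp (θ q)) p) _ (chartPt p) :=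
    (ContinuousLinearMap.compL ℝ Plane F G B).hasFDerivAt.comp (chartPt p) hθ.hasFDerivAt
  simp only [extD_eq]
  rw [h.fderiv, map_sub]
  rfl

theorem hasFDerivAt_coordForm_bilinForm (B : E →L[ℝ] F →L[ℝ] G) {f : M → E}
    {θ : ∀ p : M, TangentSpace 𝓘(ℝ, Plane) p →L[ℝ] F}
    (hf : MDifferentiableAt 𝓘(ℝ, Plane) 𝓘(ℝ, E) f p) (hθ : FormDiffAt θ p) :
    HasFDerivAt (coordForm (bilinForm B f θ) p)
      (((ContinuousLinearMap.compL ℝ Plane F G).comp B).precompR Plane (f p)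
          (fderiv ℝ (coordForm θ p) (chartPt p))
        + ((ContinuousLinearMap.compL ℝ Plane F G).comp B).precompL Plane (dmapRep f p)
          (coordForm θ p (chartPt p))) (chartPt p) := by
  have h := ((ContinuousLinearMap.compL ℝ Plane F G).comp B).hasFDerivAt_of_bilinear
    (hasFDerivAt_chartRep hf) hθ.hasFDerivAt
  rw [chartRep_chartPt] at h
  exact h

theorem formDiffAt_bilinForm (B : E →L[ℝ] F →L[ℝ] G) {f : M → E}
    {θ : ∀ p : M, TangentSpace 𝓘(ℝ, Plane) p →L[ℝ] F}
    (hf : MDifferentiableAt 𝓘(ℝ, Plane) 𝓘(ℝ, E) f p) (hθ : FormDiffAt θ p) :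
    FormDiffAt (bilinForm B f θ) p :=
  (hasFDerivAt_coordForm_bilinForm B hf hθ).differentiableAt

theorem eventually_mem_target (p : M) :
    ∀ᶠ x in 𝓝 (chartPt p), x ∈ (extChartAt 𝓘(ℝ, Plane) p).target :=
  extChartAt_target_mem_nhds p

/-- The endomorphism `J` with `*θ = θ ∘ J`, in the chart at `p`. -/
noncomputable def hodgeRep (c : LorentzConformalStructure M) (p : M) (x : Plane) :
    Plane →L[ℝ] Plane :=
  (dmap (extChartAt 𝓘(ℝ, Plane) p) ((extChartAt 𝓘(ℝ, Plane) p).symm x)).comp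
    ((c.hodge ((extChartAt 𝓘(ℝ, Plane) p).symm x)).comp (chartFrame p x))

theorem contDiffAt_hodgeRep (c : LorentzConformalStructure M) (p : M) :
    ContDiffAt ℝ ∞ (hodgeRep c p) (chartPt p) := by
  have h : ContDiffOn ℝ ∞ (hodgeRep c p) (extChartAt 𝓘(ℝ, Plane) p).target :=
    contDiffOn_clm_apply.2 fun u => c.smooth_hodge p u
  exact h.contDiffAt (extChartAt_target_mem_nhds p)

variable [IsManifold 𝓘(ℝ, Plane) ∞ M]

theorem chartFrame_comp_chart (p : M) {x : Plane} (hx : x ∈ (extChartAt 𝓘(ℝ, Plane) p).target)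
    (v : TangentSpace 𝓘(ℝ, Plane) ((extChartAt 𝓘(ℝ, Plane) p).symm x)) :
    chartFrame p x (dmap (extChartAt 𝓘(ℝ, Plane) p) ((extChartAt 𝓘(ℝ, Plane) p).symm x) v)
      = v := by
  have h := mfderivWithin_extChartAt_symm_comp_mfderiv_extChartAt (I := 𝓘(ℝ, Plane)) hx
  rw [modelWithCornersSelf_coe, Set.range_id, mfderivWithin_univ] at h
  exact DFunLike.congr_fun h v

theorem chartFrame_chartPt (p : M) :
    (chartFrame p (chartPt p) : Plane →L[ℝ] Plane) = ContinuousLinearMap.id ℝ Plane := by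
  have h := mfderivWithin_range_extChartAt_symm (I := 𝓘(ℝ, Plane)) (x := p)
  rw [modelWithCornersSelf_coe, Set.range_id, mfderivWithin_univ] at h
  exact h

theorem coordForm_chartPt (θ : ∀ p : M, TangentSpace 𝓘(ℝ, Plane) p →L[ℝ] F) (p : M) :
    coordForm θ p (chartPt p) = (θ p : Plane →L[ℝ] F) := by
  have hp : (extChartAt 𝓘(ℝ, Plane) p).symm (chartPt p) = p := by simp [chartPt]
  have hθ : (θ ((extChartAt 𝓘(ℝ, Plane) p).symm (chartPt p)) : Plane →L[ℝ] F) = θ p :=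
    congrArg (β := Plane →L[ℝ] F) θ hp
  calc coordForm θ p (chartPt p)
      = (θ ((extChartAt 𝓘(ℝ, Plane) p).symm (chartPt p)) : Plane →L[ℝ] F).comp
          (chartFrame p (chartPt p) : Plane →L[ℝ] Plane) := rfl
    _ = (θ p : Plane →L[ℝ] F).comp (ContinuousLinearMap.id ℝ Plane) := by
      rw [hθ, chartFrame_chartPt]
      rfl
    _ = _ := rfl

theorem extD_bilinForm (B : E →L[ℝ] F →L[ℝ] G) {f : M → E}
    {θ : ∀ p : M, TangentSpace 𝓘(ℝ, Plane) p →L[ℝ] F}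
    (hf : MDifferentiableAt 𝓘(ℝ, Plane) 𝓘(ℝ, E) f p) (hθ : FormDiffAt θ p)
    (X Y : TangentSpace 𝓘(ℝ, Plane) p) :
    extD (bilinForm B f θ) p X Y = B (dmap f p X) (θ p Y) - B (dmap f p Y) (θ p X)
      + B (f p) (extD θ p X Y) := by
  rw [extD_eq, (hasFDerivAt_coordForm_bilinForm B hf hθ).fderiv, coordForm_chartPt, extD_eq,
    map_sub]
  change (B (f p) (fderiv ℝ (coordForm θ p) (chartPt p) X Y) + B (dmap f p X) (θ p Y))
    - (B (f p) (fderiv ℝ (coordForm θ p) (chartPt p) Y X) + B (dmap f p Y) (θ p X)) = _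
  rw [add_sub_add_comm, add_comm]

theorem coordForm_dmap {f : M → F} (hf : MDifferentiable 𝓘(ℝ, Plane) 𝓘(ℝ, F) f) (p : M)
    {x : Plane} (hx : x ∈ (extChartAt 𝓘(ℝ, Plane) p).target) :
    coordForm (dmap f) p x = fderiv ℝ (chartRep f p) x := by
  have h := mdifferentiableWithinAt_extChartAt_symm (I := 𝓘(ℝ, Plane)) hx
  rw [modelWithCornersSelf_coe, Set.range_id, mdifferentiableWithinAt_univ] at h
  rw [← mfderiv_eq_fderiv]
  exact (mfderiv_comp x (hf _) h).symm

theorem coordForm_dmap_eventuallyEq {f : M → F}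
    (hf : MDifferentiable 𝓘(ℝ, Plane) 𝓘(ℝ, F) f) (p : M) :
    coordForm (dmap f) p =ᶠ[𝓝 (chartPt p)] fderiv ℝ (chartRep f p) :=
  (eventually_mem_target p).mono fun _ hx => coordForm_dmap hf p hx

theorem formDiffAt_dmap {f : M → F} (hf : ContMDiff 𝓘(ℝ, Plane) 𝓘(ℝ, F) ∞ f) (p : M) :
    FormDiffAt (dmap f) p := by
  have hle : (1 : WithTop ℕ∞) + 1 ≤ ∞ := one_add_one_eq_two.trans_le ENat.LEInfty.out
  exact (((contDiffAt_chartRep (hf p)).fderiv_right hle).differentiableAt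
    one_ne_zero).congr_of_eventuallyEq
      (coordForm_dmap_eventuallyEq (hf.mdifferentiable (by simp)) p)

theorem extD_dmap {f : M → F} (hf : ContMDiff 𝓘(ℝ, Plane) 𝓘(ℝ, F) ∞ f) (p : M)
    (X Y : TangentSpace 𝓘(ℝ, Plane) p) : extD (dmap f) p X Y = 0 := by
  rw [extD_eq, (coordForm_dmap_eventuallyEq (hf.mdifferentiable (by simp)) p).fderiv_eq,
    sub_eq_zero]
  exact ((contDiffAt_chartRep (hf p)).isSymmSndFDerivAt
    (minSmoothness_of_isRCLikeNormedField.trans_le ENat.LEInfty.out)) X Y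

theorem coordForm_hodgeStar (c : LorentzConformalStructure M)
    (θ : ∀ p : M, TangentSpace 𝓘(ℝ, Plane) p →L[ℝ] F) (p : M)
    {x : Plane} (hx : x ∈ (extChartAt 𝓘(ℝ, Plane) p).target) :
    coordForm (hodgeStar c θ) p x = (coordForm θ p x).comp (hodgeRep c p x) := by
  ext1 v
  have h := chartFrame_comp_chart p hx
    (c.hodge ((extChartAt 𝓘(ℝ, Plane) p).symm x) (chartFrame p x v))
  exact congrArg (θ ((extChartAt 𝓘(ℝ, Plane) p).symm x)) h.symm

theorem formDiffAt_hodgeStar (c : LorentzConformalStructure M)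
    {θ : ∀ p : M, TangentSpace 𝓘(ℝ, Plane) p →L[ℝ] F}
    (hθ : FormDiffAt θ p) : FormDiffAt (hodgeStar c θ) p :=
  (hθ.clm_comp ((contDiffAt_hodgeRep c p).differentiableAt (by simp))).congr_of_eventuallyEq
    ((eventually_mem_target p).mono fun _ hx => coordForm_hodgeStar c θ p hx)

end Calculus

/-! ### Pairs of null lines in `ℂ³` -/

theorem gamma_swap (l m : Submodule ℂ C3) (z : ℂ) : gamma l m z = gamma m l z⁻¹ := by
  have h : IsGamma l m z = IsGamma m l z⁻¹ := by
    ext g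
    unfold IsGamma
    rw [sup_comm, inv_inv]
    tauto
  unfold gamma
  rw [h]

theorem linearIndependent_of_span_inf_eq_bot {u w : C3} (hu : u ≠ 0) (hw : w ≠ 0)
    (h : Submodule.span ℂ {u} ⊓ Submodule.span ℂ {w} = ⊥) : LinearIndependent ℂ ![u, w] := by
  rw [LinearIndependent.pair_iff' hu]
  rintro k rfl
  have hmem : k • u ∈ Submodule.span ℂ {u} ⊓ Submodule.span ℂ {k • u} :=
    ⟨Submodule.smul_mem _ k (Submodule.mem_span_singleton_self u),
      Submodule.mem_span_singleton_self _⟩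
  rw [h, Submodule.mem_bot] at hmem
  exact hw hmem

/-- The rank one endomorphism `v ↦ (w · v) u`; if `u · w = 1`, this is the projection to the line
of `u` along the orthogonal complement of `w`. -/
noncomputable def lineProj (u w : C3) : EndC3 :=
  LinearMap.toContinuousLinearMap ((dotProductBilin ℂ ℂ w).smulRight u)

theorem lineProj_apply (u w v : C3) : lineProj u w v = (w ⬝ᵥ v) • u := rfl

theorem crossEnd_apply (a v : C3) : crossEnd a v = crossProduct a v := rfl

theorem crossEnd_add (v w : C3) : crossEnd (v + w) = crossEnd v + crossEnd w := by
  ext1 u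
  simp [crossEnd_apply]

theorem crossEnd_smul (k : ℂ) (w : C3) : crossEnd (k • w) = k • crossEnd w := by
  ext1 u
  simp [crossEnd_apply]

theorem crossEnd_cross (u w : C3) : crossEnd (crossProduct u w) = lineProj w u - lineProj u w := by
  ext1 v
  rw [crossEnd_apply, cross_cross_eq_smul_sub_smul]
  rfl

/-- The projection to the orthogonal complement of a hyperbolic pair. -/
noncomputable def perpProj (u w : C3) : EndC3 := 1 - lineProj u w - lineProj w u

theorem perpProj_apply (u w v : C3) : perpProj u w v = v - (w ⬝ᵥ v) • u - (u ⬝ᵥ v) • w := rfl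

/-- A pair of null vectors, normalized by `u · w = 1`. Two distinct null lines of `ℂ³` are spanned
by such a pair. -/
structure IsHyperbolicPair (u w : C3) : Prop where
  left_null : u ⬝ᵥ u = 0
  right_null : w ⬝ᵥ w = 0
  dot_eq_one : u ⬝ᵥ w = 1

namespace IsHyperbolicPair

variable {u w : C3} (h : IsHyperbolicPair u w)

include h

theorem symm : IsHyperbolicPair w u :=
  ⟨h.right_null, h.left_null, (dotProduct_comm w u).trans h.dot_eq_one⟩

theorem linearIndependent : LinearIndependent ℂ ![u, w] := by
  have hu : u ≠ 0 := by
    rintro rfl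
    simpa using h.dot_eq_one
  rw [LinearIndependent.pair_iff' hu]
  rintro k rfl
  simpa [dotProduct_smul, h.left_null] using h.dot_eq_one

theorem isGamma (z : ℂ) : IsGamma (Submodule.span ℂ {u}) (Submodule.span ℂ {w}) z
    (perpProj u w + z • lineProj u w + z⁻¹ • lineProj w u) := by
  have happly : ∀ v, (perpProj u w + z • lineProj u w + z⁻¹ • lineProj w u) v =
      v - (w ⬝ᵥ v) • u - (u ⬝ᵥ v) • w + z • (w ⬝ᵥ v) • u + z⁻¹ • (u ⬝ᵥ v) • w := fun _ => rfl
  refine ⟨fun v hv => ?_, fun v hv => ?_, fun v hv => ?_⟩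
  · obtain ⟨k, rfl⟩ := Submodule.mem_span_singleton.1 hv
    rw [happly, dotProduct_smul, dotProduct_smul, h.left_null, h.symm.dot_eq_one]
    module
  · rw [happly, dotProduct_comm w, dotProduct_comm u,
      hv u (Submodule.mem_sup_left (Submodule.mem_span_singleton_self u)),
      hv w (Submodule.mem_sup_right (Submodule.mem_span_singleton_self w))]
    module
  · obtain ⟨k, rfl⟩ := Submodule.mem_span_singleton.1 hv
    rw [happly, dotProduct_smul, dotProduct_smul, h.right_null, h.dot_eq_one]
    module

theorem gamma_eq (z : ℂ) : gamma (Submodule.span ℂ {u}) (Submodule.span ℂ {w}) z =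
    perpProj u w + z • lineProj u w + z⁻¹ • lineProj w u :=
  IsGamma.unique h.left_null h.right_null h.linearIndependent
    (gamma_spec h.left_null h.right_null h.linearIndependent z) (h.isGamma z)

theorem gamma_apply (z : ℂ) (v : C3) :
    gamma (Submodule.span ℂ {u}) (Submodule.span ℂ {w}) z v =
      v + ((z - 1) * (w ⬝ᵥ v)) • u + ((z⁻¹ - 1) * (u ⬝ᵥ v)) • w := by
  rw [h.gamma_eq]
  simp only [_root_.add_apply, _root_.smul_apply, lineProj_apply, perpProj_apply]
  module

theorem gamma_comp_gamma_inv {z : ℂ} (hz : z ≠ 0) :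
    (gamma (Submodule.span ℂ {u}) (Submodule.span ℂ {w}) z).comp
      (gamma (Submodule.span ℂ {u}) (Submodule.span ℂ {w}) z⁻¹) =
        ContinuousLinearMap.id ℂ C3 := by
  ext1 v
  rw [ContinuousLinearMap.comp_apply, ContinuousLinearMap.id_apply, h.gamma_apply, h.gamma_apply]
  simp only [dotProduct_add, dotProduct_smul, h.left_null, h.right_null, h.dot_eq_one,
    h.symm.dot_eq_one, inv_inv, smul_eq_mul]
  match_scalars <;> field_simp <;> ring

theorem gamma_inverse {z : ℂ} (hz : z ≠ 0) :
    (gamma (Submodule.span ℂ {u}) (Submodule.span ℂ {w}) z).inverse =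
      gamma (Submodule.span ℂ {u}) (Submodule.span ℂ {w}) z⁻¹ := by
  refine ContinuousLinearMap.inverse_eq (h.gamma_comp_gamma_inv hz) ?_
  simpa only [inv_inv] using h.gamma_comp_gamma_inv (inv_ne_zero hz)

theorem decomp (v : C3) : v = (w ⬝ᵥ v) • u + (u ⬝ᵥ v) • w
    - (crossProduct u w ⬝ᵥ v) • crossProduct u w := by
  have hv := cross_cross_eq_smul_sub_smul' (crossProduct u w) v (crossProduct u w)
  rw [cross_cross_eq_smul_sub_smul' v u w, map_sub, map_smul, map_smul,
    cross_cross_eq_smul_sub_smul, cross_cross_eq_smul_sub_smul, cross_dot_cross,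
    h.left_null, h.right_null, h.dot_eq_one, h.symm.dot_eq_one, dotProduct_comm v w,
    dotProduct_comm v (crossProduct u w)] at hv
  linear_combination (norm := module) hv

theorem cross_cross_left : crossProduct u (crossProduct u w) = u := by
  rw [cross_cross_eq_smul_sub_smul', h.dot_eq_one, h.left_null]
  module

theorem cross_cross_right : crossProduct w (crossProduct u w) = -w := by
  rw [cross_cross_eq_smul_sub_smul', h.right_null, h.dot_eq_one]
  module

theorem gamma_cross {z : ℂ} (hz : z ≠ 0) (a b : C3) :
    gamma (Submodule.span ℂ {u}) (Submodule.span ℂ {w}) z (crossProduct a b) =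
      crossProduct (gamma (Submodule.span ℂ {u}) (Submodule.span ℂ {w}) z a)
        (gamma (Submodule.span ℂ {u}) (Submodule.span ℂ {w}) z b) := by
  set n := crossProduct u w with hn
  set g := gamma (Submodule.span ℂ {u}) (Submodule.span ℂ {w}) z with hg
  have hun : crossProduct u n = u := h.cross_cross_left
  have hwn : crossProduct w n = -w := h.cross_cross_right
  have hgu : g u = z • u := by
    rw [hg, h.gamma_apply, h.left_null, h.symm.dot_eq_one]
    module
  have hgw : g w = z⁻¹ • w := by
    rw [hg, h.gamma_apply, h.right_null, h.dot_eq_one]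
    module
  have hgn : g n = n := by
    rw [hg, h.gamma_apply, hn, dot_cross_self, dot_self_cross]
    module
  rw [h.decomp a, h.decomp b, ← hn]
  simp only [map_add, map_sub, map_smul, hgu, hgw, hgn, LinearMap.add_apply, LinearMap.sub_apply,
    LinearMap.smul_apply, cross_self, hun, hwn, ← cross_anticomm u w, ← cross_anticomm u n,
    ← cross_anticomm w n, ← hn, map_neg, map_zero]
  match_scalars <;> field_simp

theorem gamma_eq_of_dotProduct {z : ℂ} {x y : C3} (hu : u ⬝ᵥ y = z⁻¹ * (u ⬝ᵥ x))
    (hw : w ⬝ᵥ y = z * (w ⬝ᵥ x)) (huw : crossProduct u w ⬝ᵥ y = crossProduct u w ⬝ᵥ x) :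
    gamma (Submodule.span ℂ {u}) (Submodule.span ℂ {w}) z x = y := by
  have hx := h.decomp x
  have hy := h.decomp y
  rw [hu, hw, huw] at hy
  rw [h.gamma_apply]
  linear_combination (norm := module) hx - hy

theorem hasDerivAt_gamma {ψ : ℂ → ℂ} {ψ' z : ℂ} (hψ : HasDerivAt ψ ψ' z) (h1 : ψ z = 1) :
    HasDerivAt (fun ζ => gamma (Submodule.span ℂ {u}) (Submodule.span ℂ {w}) (ψ ζ))
      (crossEnd (ψ' • crossProduct w u)) z := by
  simp only [h.gamma_eq]
  have hinv : HasDerivAt (fun ζ => (ψ ζ)⁻¹) (-ψ') z := by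
    simpa [h1] using hψ.fun_inv (h1 ▸ one_ne_zero)
  refine (((hψ.smul_const (lineProj u w)).const_add (perpProj u w)).add
    (hinv.smul_const (lineProj w u))).congr_deriv ?_
  rw [crossEnd_smul, crossEnd_cross]
  module

end IsHyperbolicPair

/-! ### Covariant derivatives of sections -/

/-- The dot product of `ℂ³` as a continuous real-bilinear map. -/
noncomputable def dotB : C3 →L[ℝ] C3 →L[ℝ] ℂ :=
  LinearMap.toContinuousBilinearMap
    (LinearMap.mk₂ ℝ (fun u v : C3 => u ⬝ᵥ v) add_dotProduct smul_dotProduct dotProduct_add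
      (fun k u v => dotProduct_smul k u v))

theorem dotB_apply (u v : C3) : dotB u v = u ⬝ᵥ v := rfl

/-- Scalar multiplication on `ℂ³` as a continuous real-bilinear map. -/
noncomputable abbrev smulB : ℂ →L[ℝ] C3 →L[ℝ] C3 := ContinuousLinearMap.lsmul ℝ ℂ

section Covariant

variable {M : Type*} [TopologicalSpace M] [ChartedSpace Plane M]
variable {A : ConnForm M} {s s' : M → C3} {p : M}

theorem covD_congr (h : s =ᶠ[𝓝 p] s') (X : TangentSpace 𝓘(ℝ, Plane) p) :
    covD A s p X = covD A s' p X := by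
  rw [covD, covD, dmap_congr h, h.self_of_nhds]

theorem covD_add (hs : MDifferentiableAt 𝓘(ℝ, Plane) 𝓘(ℝ, C3) s p)
    (hs' : MDifferentiableAt 𝓘(ℝ, Plane) 𝓘(ℝ, C3) s' p) (X : TangentSpace 𝓘(ℝ, Plane) p) :
    covD A (fun q => s q + s' q) p X = covD A s p X + covD A s' p X := by
  simp only [covD, dmap_add hs hs', map_add]
  exact add_add_add_comm _ _ _ _

theorem contMDiffAt_dotProduct (hs : ContMDiffAt 𝓘(ℝ, Plane) 𝓘(ℝ, C3) ∞ s p)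
    (hs' : ContMDiffAt 𝓘(ℝ, Plane) 𝓘(ℝ, C3) ∞ s' p) :
    ContMDiffAt 𝓘(ℝ, Plane) 𝓘(ℝ, ℂ) ∞ (fun q => s q ⬝ᵥ s' q) p :=
  contMDiffAt_bilin dotB hs hs'

theorem mdifferentiableAt_dotProduct (hs : MDifferentiableAt 𝓘(ℝ, Plane) 𝓘(ℝ, C3) s p)
    (hs' : MDifferentiableAt 𝓘(ℝ, Plane) 𝓘(ℝ, C3) s' p) :
    MDifferentiableAt 𝓘(ℝ, Plane) 𝓘(ℝ, ℂ) (fun q => s q ⬝ᵥ s' q) p :=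
  mdifferentiableAt_bilin dotB hs hs'

theorem IsMetricConn.dmap_dotProduct (hA : IsMetricConn A)
    (hs : MDifferentiableAt 𝓘(ℝ, Plane) 𝓘(ℝ, C3) s p)
    (hs' : MDifferentiableAt 𝓘(ℝ, Plane) 𝓘(ℝ, C3) s' p) (X : TangentSpace 𝓘(ℝ, Plane) p) :
    dmap (fun q => s q ⬝ᵥ s' q) p X = covD A s p X ⬝ᵥ s' p + s p ⬝ᵥ covD A s' p X := by
  have h := dmap_bilin dotB hs hs' X
  simp only [dotB_apply] at h
  rw [h, covD, covD, add_dotProduct, dotProduct_add]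
  linear_combination -hA p X (s p) (s' p)

theorem IsMetricConn.dotProduct_covD_of_orthogonal (hA : IsMetricConn A)
    (hs : MDifferentiableAt 𝓘(ℝ, Plane) 𝓘(ℝ, C3) s p)
    (hs' : MDifferentiableAt 𝓘(ℝ, Plane) 𝓘(ℝ, C3) s' p) (h : ∀ᶠ q in 𝓝 p, s q ⬝ᵥ s' q = 0)
    (X : TangentSpace 𝓘(ℝ, Plane) p) : s p ⬝ᵥ covD A s' p X = -(s' p ⬝ᵥ covD A s p X) := by
  have hconst : (fun q => s q ⬝ᵥ s' q) =ᶠ[𝓝 p] fun _ => 0 := h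
  have hd := hA.dmap_dotProduct hs hs' X
  rw [dmap_congr hconst, dmap_const, dotProduct_comm _ (s' p)] at hd
  exact eq_neg_of_add_eq_zero_right hd.symm

theorem IsMetricConn.dotProduct_covD_self_of_null (hA : IsMetricConn A)
    (hs : MDifferentiableAt 𝓘(ℝ, Plane) 𝓘(ℝ, C3) s p) (h : ∀ᶠ q in 𝓝 p, s q ⬝ᵥ s q = 0)
    (X : TangentSpace 𝓘(ℝ, Plane) p) : s p ⬝ᵥ covD A s p X = 0 :=
  self_eq_neg.1 (hA.dotProduct_covD_of_orthogonal hs hs h X)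

variable {k : M → ℂ}

theorem mdifferentiableAt_smul (hk : MDifferentiableAt 𝓘(ℝ, Plane) 𝓘(ℝ, ℂ) k p)
    (hs : MDifferentiableAt 𝓘(ℝ, Plane) 𝓘(ℝ, C3) s p) :
    MDifferentiableAt 𝓘(ℝ, Plane) 𝓘(ℝ, C3) (fun q => k q • s q) p :=
  mdifferentiableAt_bilin smulB hk hs

theorem covD_smul (hk : MDifferentiableAt 𝓘(ℝ, Plane) 𝓘(ℝ, ℂ) k p)
    (hs : MDifferentiableAt 𝓘(ℝ, Plane) 𝓘(ℝ, C3) s p) (X : TangentSpace 𝓘(ℝ, Plane) p) :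
    covD A (fun q => k q • s q) p X = dmap k p X • s p + k p • covD A s p X := by
  have h := dmap_bilin smulB hk hs X
  simp only [ContinuousLinearMap.lsmul_apply] at h
  simp only [covD, h, map_smul, smul_add]
  abel

theorem covD_const_smul (z : ℂ) (hs : MDifferentiableAt 𝓘(ℝ, Plane) 𝓘(ℝ, C3) s p)
    (X : TangentSpace 𝓘(ℝ, Plane) p) : covD A (fun q => z • s q) p X = z • covD A s p X := by
  rw [covD_smul (k := fun _ => z) mdifferentiableAt_const hs, dmap_const]
  simp

theorem contMDiffAt_inv {f : M → ℂ} (hf : ContMDiffAt 𝓘(ℝ, Plane) 𝓘(ℝ, ℂ) ∞ f p)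
    (h : f p ≠ 0) : ContMDiffAt 𝓘(ℝ, Plane) 𝓘(ℝ, ℂ) ∞ (fun q => (f q)⁻¹) p :=
  ((contDiffAt_inv ℂ h).restrict_scalars ℝ).contMDiffAt.comp p hf

theorem analyticAt_covD {A : ℂ → ConnForm M} {α : ℂ} {X : TangentSpace 𝓘(ℝ, Plane) p}
    (hA : AnalyticAt ℂ (fun z => A z p X) α) (s : M → C3) :
    AnalyticAt ℂ (fun z => covD (A z) s p X) α :=
  analyticAt_const.add (((ContinuousLinearMap.apply ℂ C3 (s p)).analyticAt _).comp hA)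

theorem holomorphicAcross_of_eventuallyEq_covD {D : ℂ → SectionOp M} {B : ℂ → ConnForm M} {α : ℂ}
    (hB : ∀ p (X : TangentSpace 𝓘(ℝ, Plane) p), AnalyticAt ℂ (fun z => B z p X) α)
    (hD : ∀ᶠ z in 𝓝[≠] α, ∀ (s : M → C3) (p : M), ContMDiffAt 𝓘(ℝ, Plane) 𝓘(ℝ, C3) ∞ s p →
      ∀ X : TangentSpace 𝓘(ℝ, Plane) p, D z s p X = covD (B z) s p X) :
    HolomorphicAcross D α := fun s p hs X =>
  ⟨fun z => covD (B z) s p X, analyticAt_covD (hB p X) s, hD.mono fun _ hz => hz s p hs X⟩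

end Covariant

/-! ### Gauging by `Γ` near a simple zero of its parameter -/

theorem exists_analyticAt_inv_smul_iff {E : Type*} [NormedAddCommGroup E] [NormedSpace ℂ E]
    {ψ : ℂ → ℂ} {Q : ℂ → E} {α : ℂ} (hψ : AnalyticAt ℂ ψ α) (hord : analyticOrderAt ψ α = 1)
    (hQ : AnalyticAt ℂ Q α) :
    (∃ h : ℂ → E, AnalyticAt ℂ h α ∧ (fun z => (ψ z)⁻¹ • Q z) =ᶠ[𝓝[≠] α] h) ↔ Q α = 0 := by
  obtain ⟨φ, hφ, hφα, hψφ⟩ := hψ.analyticOrderAt_eq_natCast (n := 1) |>.1 (by simpa using hord)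
  have hne : ∀ᶠ z in 𝓝[≠] α, φ z ≠ 0 :=
    (hφ.continuousAt.eventually_ne hφα).filter_mono nhdsWithin_le_nhds
  have hψφ' : ∀ᶠ z in 𝓝[≠] α, ψ z = (z - α) ^ 1 • φ z := hψφ.filter_mono nhdsWithin_le_nhds
  constructor
  · rintro ⟨h, hh, heq⟩
    have hmul : Q =ᶠ[𝓝[≠] α] fun z => ψ z • h z := by
      filter_upwards [heq, hne, hψφ', self_mem_nhdsWithin] with z hz hφz hψz hzα
      have hψz0 : ψ z ≠ 0 := by
        rw [hψz, pow_one]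
        exact smul_ne_zero (sub_ne_zero.2 hzα) hφz
      rw [← hz, smul_inv_smul₀ hψz0]
    have heq' := (hQ.frequently_eq_iff_eventually_eq (hψ.fun_smul hh)).1 hmul.frequently
    rw [heq'.self_of_nhds, hψφ.self_of_nhds]
    simp
  · intro h0
    have hpos : ((1 : ℕ) : ℕ∞) ≤ analyticOrderAt Q α := by
      rw [Nat.cast_one, Order.one_le_iff_ne_zero]
      exact fun h => hQ.analyticOrderAt_eq_zero.1 h h0
    obtain ⟨g, hg, hQg⟩ := (natCast_le_analyticOrderAt hQ).1 hpos
    refine ⟨fun z => (φ z)⁻¹ • g z, (hφ.inv hφα).fun_smul hg, ?_⟩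
    filter_upwards [hψφ', hQg.filter_mono nhdsWithin_le_nhds, self_mem_nhdsWithin] with z hz hz' hzα
    have hzα' : z - α ≠ 0 := sub_ne_zero.2 hzα
    rw [hz, hz', pow_one, smul_eq_mul, smul_smul, mul_inv_rev, inv_mul_cancel_right₀ hzα']

section GaugedFamily

variable {M : Type*} [TopologicalSpace M] [ChartedSpace Plane M]

/-- Near `p`, the line bundles `L` and `L'` are spanned by the smooth sections `u` and `w`, which
form hyperbolic pairs. -/
structure IsLocalHyperbolicFrame (L L' : M → Submodule ℂ C3) (u w : M → C3) (p : M) : Prop where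
  smooth_left : ContMDiffAt 𝓘(ℝ, Plane) 𝓘(ℝ, C3) ∞ u p
  smooth_right : ContMDiffAt 𝓘(ℝ, Plane) 𝓘(ℝ, C3) ∞ w p
  pair : ∀ᶠ q in 𝓝 p, IsHyperbolicPair (u q) (w q)
  span_left : ∀ᶠ q in 𝓝 p, L q = Submodule.span ℂ {u q}
  span_right : ∀ᶠ q in 𝓝 p, L' q = Submodule.span ℂ {w q}

theorem IsNullLineSubbundle.exists_local_section {L : M → Submodule ℂ C3}
    (hL : IsNullLineSubbundle L) (p : M) :
    ∃ s : M → C3, ContMDiffAt 𝓘(ℝ, Plane) 𝓘(ℝ, C3) ∞ s p ∧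
      ∀ᶠ q in 𝓝 p, s q ≠ 0 ∧ s q ⬝ᵥ s q = 0 ∧ L q = Submodule.span ℂ {s q} := by
  obtain ⟨U, hU, s, hs, h⟩ := hL.smooth p
  refine ⟨s, hs.contMDiffAt hU, Filter.mem_of_superset hU fun q hq => ⟨(h q hq).1, ?_, (h q hq).2⟩⟩
  apply hL.null q
  rw [(h q hq).2]
  exact Submodule.mem_span_singleton_self _

theorem exists_isLocalHyperbolicFrame {L L' : M → Submodule ℂ C3} (hL : IsNullLineSubbundle L)
    (hL' : IsNullLineSubbundle L') (hLL' : ∀ p, L p ⊓ L' p = ⊥) (p : M) :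
    ∃ u w, IsLocalHyperbolicFrame L L' u w p := by
  obtain ⟨u, hus, hu⟩ := hL.exists_local_section p
  obtain ⟨w, hws, hw⟩ := hL'.exists_local_section p
  have huw : ∀ᶠ q in 𝓝 p, u q ⬝ᵥ w q ≠ 0 := by
    filter_upwards [hu, hw] with q hq hq'
    have hbot := hLL' q
    rw [hq.2.2, hq'.2.2] at hbot
    exact dot_ne_zero_of_null hq.2.1 hq'.2.1
      (linearIndependent_of_span_inf_eq_bot hq.1 hq'.1 hbot)
  have hinv : ContMDiffAt 𝓘(ℝ, Plane) 𝓘(ℝ, ℂ) ∞ (fun q => (u q ⬝ᵥ w q)⁻¹) p :=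
    contMDiffAt_inv (contMDiffAt_dotProduct hus hws) huw.self_of_nhds
  refine ⟨u, fun q => (u q ⬝ᵥ w q)⁻¹ • w q, hus, contMDiffAt_bilin smulB hinv hws, ?_, ?_, ?_⟩
  · filter_upwards [hu, hw, huw] with q hq hq' hne
    refine ⟨hq.2.1, ?_, ?_⟩
    · simp [hq'.2.1]
    · rw [dotProduct_smul, smul_eq_mul, inv_mul_cancel₀ hne]
  · exact hu.mono fun q hq => hq.2.2
  · filter_upwards [hw, huw] with q hq hne
    rw [hq.2.2, Submodule.span_singleton_smul_eq (inv_ne_zero hne).isUnit]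

/-- The coefficient of `ζ⁻¹` in `Γ(ζ) ∘ D ∘ Γ(ζ)⁻¹`, where `D = d + A`, applied to the section
`s`. -/
noncomputable def polarPart (u w : M → C3) (A : ConnForm M) (s : M → C3) (p : M)
    (X : TangentSpace 𝓘(ℝ, Plane) p) : C3 :=
  perpProj (u p) (w p) (covD A (fun q => lineProj (u q) (w q) (s q)) p X)
    + lineProj (w p) (u p) (covD A (fun q => perpProj (u q) (w q) (s q)) p X)

/-- The part of `Γ(ζ) ∘ D ∘ Γ(ζ)⁻¹` which is polynomial in `ζ`, applied to the section `s`. -/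
noncomputable def regularPart (u w : M → C3) (A : ConnForm M) (ζ : ℂ) (s : M → C3) (p : M)
    (X : TangentSpace 𝓘(ℝ, Plane) p) : C3 :=
  perpProj (u p) (w p) (covD A (fun q => perpProj (u q) (w q) (s q)) p X)
    + lineProj (u p) (w p) (covD A (fun q => lineProj (u q) (w q) (s q)) p X)
    + lineProj (w p) (u p) (covD A (fun q => lineProj (w q) (u q) (s q)) p X)
    + ζ • (perpProj (u p) (w p) (covD A (fun q => lineProj (w q) (u q) (s q)) p X)
      + lineProj (u p) (w p) (covD A (fun q => perpProj (u q) (w q) (s q)) p X))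

theorem analyticAt_polarPart {u w : M → C3} {A : ℂ → ConnForm M} {α : ℂ} {p : M}
    {X : TangentSpace 𝓘(ℝ, Plane) p} (hA : AnalyticAt ℂ (fun z => A z p X) α) (s : M → C3) :
    AnalyticAt ℂ (fun z => polarPart u w (A z) s p X) α := by
  have han (P : EndC3) (σ : M → C3) : AnalyticAt ℂ (fun z => P (covD (A z) σ p X)) α :=
    (P.analyticAt _).comp (analyticAt_covD hA σ)
  exact (han _ _).add (han _ _)

theorem analyticAt_regularPart {u w : M → C3} {A : ℂ → ConnForm M} {ψ : ℂ → ℂ} {α : ℂ} {p : M}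
    {X : TangentSpace 𝓘(ℝ, Plane) p} (hψ : AnalyticAt ℂ ψ α)
    (hA : AnalyticAt ℂ (fun z => A z p X) α) (s : M → C3) :
    AnalyticAt ℂ (fun z => regularPart u w (A z) (ψ z) s p X) α := by
  have han (P : EndC3) (σ : M → C3) : AnalyticAt ℂ (fun z => P (covD (A z) σ p X)) α :=
    (P.analyticAt _).comp (analyticAt_covD hA σ)
  exact (((han _ _).add (han _ _)).add (han _ _)).add (hψ.smul ((han _ _).add (han _ _)))

namespace IsLocalHyperbolicFrame

variable {L L' : M → Submodule ℂ C3} {u w : M → C3} {p : M}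
  (hF : IsLocalHyperbolicFrame L L' u w p)
include hF

theorem symm : IsLocalHyperbolicFrame L' L w u p :=
  ⟨hF.smooth_right, hF.smooth_left, hF.pair.mono fun _ h => h.symm, hF.span_right, hF.span_left⟩

theorem mdifferentiableAt_left : MDifferentiableAt 𝓘(ℝ, Plane) 𝓘(ℝ, C3) u p :=
  hF.smooth_left.mdifferentiableAt (by simp)

theorem mdifferentiableAt_right : MDifferentiableAt 𝓘(ℝ, Plane) 𝓘(ℝ, C3) w p :=
  hF.smooth_right.mdifferentiableAt (by simp)

theorem mdifferentiableAt_lineProj {s : M → C3} (hs : MDifferentiableAt 𝓘(ℝ, Plane) 𝓘(ℝ, C3) s p) :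
    MDifferentiableAt 𝓘(ℝ, Plane) 𝓘(ℝ, C3) (fun q => lineProj (u q) (w q) (s q)) p :=
  mdifferentiableAt_smul (mdifferentiableAt_dotProduct hF.mdifferentiableAt_right hs)
    hF.mdifferentiableAt_left

theorem mdifferentiableAt_perpProj {s : M → C3} (hs : MDifferentiableAt 𝓘(ℝ, Plane) 𝓘(ℝ, C3) s p) :
    MDifferentiableAt 𝓘(ℝ, Plane) 𝓘(ℝ, C3) (fun q => perpProj (u q) (w q) (s q)) p :=
  (hs.sub (hF.mdifferentiableAt_lineProj hs)).sub (hF.symm.mdifferentiableAt_lineProj hs)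

theorem contMDiffAt_lineProj {s : M → C3} (hs : ContMDiffAt 𝓘(ℝ, Plane) 𝓘(ℝ, C3) ∞ s p) :
    ContMDiffAt 𝓘(ℝ, Plane) 𝓘(ℝ, C3) ∞ (fun q => lineProj (u q) (w q) (s q)) p :=
  contMDiffAt_bilin smulB (contMDiffAt_dotProduct hF.smooth_right hs) hF.smooth_left

variable {A : ConnForm M} (hA : IsMetricConn A)
include hA

theorem lineProj_covD_lineProj {s : M → C3} (hs : MDifferentiableAt 𝓘(ℝ, Plane) 𝓘(ℝ, C3) s p)
    (X : TangentSpace 𝓘(ℝ, Plane) p) :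
    lineProj (w p) (u p) (covD A (fun q => lineProj (u q) (w q) (s q)) p X) = 0 := by
  have hnull : ∀ᶠ q in 𝓝 p, u q ⬝ᵥ lineProj (u q) (w q) (s q) = 0 := hF.pair.mono fun q hq => by
    rw [lineProj_apply, dotProduct_smul, hq.left_null, smul_zero]
  rw [lineProj_apply, hA.dotProduct_covD_of_orthogonal hF.mdifferentiableAt_left
    (hF.mdifferentiableAt_lineProj hs) hnull, lineProj_apply, smul_dotProduct,
    hA.dotProduct_covD_self_of_null hF.mdifferentiableAt_left
      (hF.pair.mono fun q hq => hq.left_null)]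
  simp

theorem gaugeAct_gamma_covD {ζ : ℂ} (hζ : ζ ≠ 0) {s : M → C3}
    (hs : MDifferentiableAt 𝓘(ℝ, Plane) 𝓘(ℝ, C3) s p) (X : TangentSpace 𝓘(ℝ, Plane) p) :
    gaugeAct (fun q => gamma (L q) (L' q) ζ) (covD A) s p X =
      regularPart u w A ζ s p X + ζ⁻¹ • polarPart u w A s p X := by
  have hP := hF.mdifferentiableAt_lineProj hs
  have hP' := hF.symm.mdifferentiableAt_lineProj hs
  have hP₀ := hF.mdifferentiableAt_perpProj hs
  have hinv : (fun q => (gamma (L q) (L' q) ζ).inverse (s q)) =ᶠ[𝓝 p]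
      fun q => perpProj (u q) (w q) (s q) + ζ⁻¹ • lineProj (u q) (w q) (s q)
        + ζ • lineProj (w q) (u q) (s q) := by
    filter_upwards [hF.pair, hF.span_left, hF.span_right] with q hq hqu hqw
    rw [hqu, hqw, hq.gamma_inverse hζ, hq.gamma_eq, inv_inv]
    rfl
  have hD : covD A (fun q => (gamma (L q) (L' q) ζ).inverse (s q)) p X =
      covD A (fun q => perpProj (u q) (w q) (s q)) p X
        + ζ⁻¹ • covD A (fun q => lineProj (u q) (w q) (s q)) p X
        + ζ • covD A (fun q => lineProj (w q) (u q) (s q)) p X := by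
    have hP_smul := mdifferentiableAt_smul (k := fun _ => ζ⁻¹) mdifferentiableAt_const hP
    have hP'_smul := mdifferentiableAt_smul (k := fun _ => ζ) mdifferentiableAt_const hP'
    rw [covD_congr hinv, ← covD_const_smul _ hP, ← covD_const_smul _ hP',
      ← covD_add hP₀ hP_smul]
    exact covD_add (hP₀.add hP_smul) hP'_smul X
  rw [gaugeAct, hD, hF.span_left.self_of_nhds, hF.span_right.self_of_nhds,
    hF.pair.self_of_nhds.gamma_eq]
  simp only [_root_.add_apply, _root_.smul_apply, map_add, map_smul,
    hF.lineProj_covD_lineProj hA hs X, hF.symm.lineProj_covD_lineProj hA hs X, regularPart,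
    polarPart]
  match_scalars <;> field_simp

omit hA

theorem mem_left_iff {v : C3} :
    v ∈ L p ↔ perpProj (u p) (w p) v = 0 ∧ lineProj (w p) (u p) v = 0 := by
  have hp := hF.pair.self_of_nhds
  rw [hF.span_left.self_of_nhds]
  constructor
  · intro hv
    obtain ⟨k, rfl⟩ := Submodule.mem_span_singleton.1 hv
    simp [perpProj_apply, lineProj_apply, hp.left_null, hp.symm.dot_eq_one]
  · rintro ⟨h₀, h₁⟩
    rw [perpProj_apply, ← lineProj_apply (w p) (u p), h₁, sub_zero, sub_eq_zero] at h₀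
    exact h₀ ▸ Submodule.smul_mem _ _ (Submodule.mem_span_singleton_self _)

theorem perpProj_add_lineProj_eq_zero_iff {v v' : C3} :
    perpProj (u p) (w p) v + lineProj (w p) (u p) v' = 0 ↔
      perpProj (u p) (w p) v = 0 ∧ lineProj (w p) (u p) v' = 0 := by
  have hp := hF.pair.self_of_nhds
  refine ⟨fun h => ?_, fun h => by rw [h.1, h.2, add_zero]⟩
  have hdot := congrArg (u p ⬝ᵥ ·) h
  simp only [perpProj_apply, lineProj_apply, dotProduct_add, dotProduct_sub, dotProduct_smul,
    hp.left_null, hp.dot_eq_one, smul_eq_mul, mul_zero, mul_one, sub_zero, sub_self, zero_add,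
    dotProduct_zero] at hdot
  have hzero : lineProj (w p) (u p) v' = 0 := by rw [lineProj_apply, hdot, zero_smul]
  exact ⟨by rwa [hzero, add_zero] at h, hzero⟩

include hA

theorem polarPart_eq_zero_of_isParallel (hpar : IsParallel (covD A) L) {s : M → C3}
    (hs : ContMDiffAt 𝓘(ℝ, Plane) 𝓘(ℝ, C3) ∞ s p) (X : TangentSpace 𝓘(ℝ, Plane) p) :
    polarPart u w A s p X = 0 := by
  have hs' := hs.mdifferentiableAt (by simp)
  have hp := hF.pair.self_of_nhds
  have huL : ∀ᶠ q in 𝓝 p, u q ∈ L q := hF.span_left.mono fun q hq => by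
    rw [hq]
    exact Submodule.mem_span_singleton_self _
  have hPs := hpar _ p (hF.contMDiffAt_lineProj hs)
    (huL.mono fun q hq => Submodule.smul_mem _ _ hq) X
  obtain ⟨k, hk⟩ : ∃ k : ℂ, k • u p = covD A u p X := by
    have hu := hpar u p hF.smooth_left huL X
    rwa [hF.span_left.self_of_nhds, Submodule.mem_span_singleton] at hu
  have horth : ∀ q, IsHyperbolicPair (u q) (w q) → u q ⬝ᵥ perpProj (u q) (w q) (s q) = 0 := by
    intro q hq
    simp [perpProj_apply, dotProduct_sub, hq.left_null, hq.dot_eq_one]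
  refine hF.perpProj_add_lineProj_eq_zero_iff.2 ⟨(hF.mem_left_iff.1 hPs).1, ?_⟩
  rw [lineProj_apply, hA.dotProduct_covD_of_orthogonal hF.mdifferentiableAt_left
    (hF.mdifferentiableAt_perpProj hs') (hF.pair.mono horth), ← hk, dotProduct_smul,
    dotProduct_comm, horth p hp, smul_zero, neg_zero, zero_smul]

theorem covD_mem_left_of_polarPart_eq_zero {s : M → C3}
    (hs : ContMDiffAt 𝓘(ℝ, Plane) 𝓘(ℝ, C3) ∞ s p) (hsL : ∀ᶠ q in 𝓝 p, s q ∈ L q)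
    (X : TangentSpace 𝓘(ℝ, Plane) p) (h : polarPart u w A s p X = 0) :
    covD A s p X ∈ L p := by
  have hs' := hs.mdifferentiableAt (by simp)
  have hPs : (fun q => lineProj (u q) (w q) (s q)) =ᶠ[𝓝 p] s := by
    filter_upwards [hF.pair, hF.span_left, hsL] with q hq hqL hsq
    rw [hqL] at hsq
    obtain ⟨k, hk⟩ := Submodule.mem_span_singleton.1 hsq
    simp [← hk, lineProj_apply, hq.symm.dot_eq_one]
  refine hF.mem_left_iff.2 ⟨?_, ?_⟩
  · rw [← covD_congr hPs X]
    exact (hF.perpProj_add_lineProj_eq_zero_iff.1 h).1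
  · rw [← covD_congr hPs X]
    exact hF.lineProj_covD_lineProj hA hs' X

omit hA

/- Near `α` the gauged family is holomorphic up to `ψ⁻¹` times the polar part. -/
theorem exists_analyticAt_gaugeAct_gamma_iff {A : ℂ → ConnForm M} (hA : ∀ z, IsMetricConn (A z))
    {ψ : ℂ → ℂ} {α : ℂ} (hψ : AnalyticAt ℂ ψ α) (hord : analyticOrderAt ψ α = 1) {s : M → C3}
    (hs : MDifferentiableAt 𝓘(ℝ, Plane) 𝓘(ℝ, C3) s p) {X : TangentSpace 𝓘(ℝ, Plane) p}
    (han : AnalyticAt ℂ (fun z => A z p X) α) :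
    (∃ h : ℂ → C3, AnalyticAt ℂ h α ∧
        (fun z => gaugeAct (fun p => gamma (L p) (L' p) (ψ z)) (covD (A z)) s p X) =ᶠ[𝓝[≠] α] h) ↔
      polarPart u w (A α) s p X = 0 := by
  have hψ_ne : ∀ᶠ z in 𝓝[≠] α, ψ z ≠ 0 :=
    hψ.eventually_eq_zero_or_eventually_ne_zero.resolve_left fun h => by
      simp [analyticOrderAt_eq_top.2 h] at hord
  have hgauge := hψ_ne.mono fun z hz => hF.gaugeAct_gamma_covD (hA z) hz hs X
  have hreg := analyticAt_regularPart (u := u) (w := w) hψ han s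
  rw [← exists_analyticAt_inv_smul_iff hψ hord (analyticAt_polarPart han s)]
  constructor
  · rintro ⟨h, hh, heq⟩
    refine ⟨_, hh.sub hreg, ?_⟩
    filter_upwards [heq, hgauge] with z hz hz'
    rw [Pi.sub_apply, ← hz, hz', add_sub_cancel_left]
  · rintro ⟨h, hh, heq⟩
    refine ⟨_, hreg.add hh, ?_⟩
    filter_upwards [heq, hgauge] with z hz hz'
    rw [hz', Pi.add_apply, ← hz]

end IsLocalHyperbolicFrame

theorem holomorphicAcross_gaugeAct_gamma_iff_isParallel {L L' : M → Submodule ℂ C3}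
    (hL : IsNullLineSubbundle L) (hL' : IsNullLineSubbundle L') (hLL' : ∀ p, L p ⊓ L' p = ⊥)
    {A : ℂ → ConnForm M} (hA : ∀ z, IsMetricConn (A z)) {ψ : ℂ → ℂ} {α : ℂ}
    (hψ : AnalyticAt ℂ ψ α) (hord : analyticOrderAt ψ α = 1)
    (han : ∀ p (X : TangentSpace 𝓘(ℝ, Plane) p), AnalyticAt ℂ (fun z => A z p X) α) :
    HolomorphicAcross (fun z => gaugeAct (fun p => gamma (L p) (L' p) (ψ z)) (covD (A z))) α ↔
      IsParallel (covD (A α)) L := by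
  constructor
  · intro h s p hs hsL X
    obtain ⟨u, w, hF⟩ := exists_isLocalHyperbolicFrame hL hL' hLL' p
    exact hF.covD_mem_left_of_polarPart_eq_zero (hA α) hs hsL X
      ((hF.exists_analyticAt_gaugeAct_gamma_iff hA hψ hord (hs.mdifferentiableAt (by simp))
        (han p X)).1 (h s p hs X))
  · intro hpar s p hs X
    obtain ⟨u, w, hF⟩ := exists_isLocalHyperbolicFrame hL hL' hLL' p
    exact (hF.exists_analyticAt_gaugeAct_gamma_iff hA hψ hord (hs.mdifferentiableAt (by simp))
      (han p X)).2 (hF.polarPart_eq_zero_of_isParallel (hA α) hpar hs X)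

end GaugedFamily

section Mobius

variable {k₁ k₂ k₃ k₄ α : ℂ}

theorem analyticAt_mobius (h : k₃ * α + k₄ ≠ 0) :
    AnalyticAt ℂ (fun z => (k₁ * z + k₂) / (k₃ * z + k₄)) α :=
  AnalyticAt.div (by fun_prop) (by fun_prop) h

theorem mobius_denom_ne_zero (hdet : k₁ * k₄ - k₂ * k₃ ≠ 0) (hα : k₁ * α + k₂ = 0) :
    k₃ * α + k₄ ≠ 0 :=
  fun h => hdet (by linear_combination k₁ * h - k₃ * hα)

theorem analyticOrderAt_mobius (hdet : k₁ * k₄ - k₂ * k₃ ≠ 0) (hα : k₁ * α + k₂ = 0) :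
    analyticOrderAt (fun z => (k₁ * z + k₂) / (k₃ * z + k₄)) α = 1 := by
  have hdenom := mobius_denom_ne_zero hdet hα
  have hk₁ : k₁ ≠ 0 := by
    rintro rfl
    exact hdet (by linear_combination (-k₃) * hα)
  refine ((analyticAt_mobius hdenom).analyticOrderAt_eq_natCast (n := 1)).2
    ⟨fun z => k₁ / (k₃ * z + k₄), AnalyticAt.div (by fun_prop) (by fun_prop) hdenom,
      div_ne_zero hk₁ hdenom, Filter.Eventually.of_forall fun z => ?_⟩
  rw [show k₁ * z + k₂ = k₁ * (z - α) by linear_combination hα, pow_one, smul_eq_mul]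
  ring

variable {M : Type*} [TopologicalSpace M] [ChartedSpace Plane M] {L L' : M → Submodule ℂ C3}
  {A : ℂ → ConnForm M}

theorem holomorphicAcross_gaugeAct_gamma_mobius_zero_iff (hL : IsNullLineSubbundle L)
    (hL' : IsNullLineSubbundle L') (hLL' : ∀ p, L p ⊓ L' p = ⊥) (hA : ∀ z, IsMetricConn (A z))
    (hdet : k₁ * k₄ - k₂ * k₃ ≠ 0) (hα : k₁ * α + k₂ = 0)
    (han : ∀ p (X : TangentSpace 𝓘(ℝ, Plane) p), AnalyticAt ℂ (fun z => A z p X) α) :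
    HolomorphicAcross
      (fun z => gaugeAct (fun p => gamma (L p) (L' p) ((k₁ * z + k₂) / (k₃ * z + k₄)))
        (covD (A z))) α ↔ IsParallel (covD (A α)) L :=
  holomorphicAcross_gaugeAct_gamma_iff_isParallel hL hL' hLL' hA
    (analyticAt_mobius (mobius_denom_ne_zero hdet hα)) (analyticOrderAt_mobius hdet hα) han

theorem holomorphicAcross_gaugeAct_gamma_mobius_pole_iff (hL : IsNullLineSubbundle L)
    (hL' : IsNullLineSubbundle L') (hLL' : ∀ p, L p ⊓ L' p = ⊥) (hA : ∀ z, IsMetricConn (A z))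
    (hdet : k₁ * k₄ - k₂ * k₃ ≠ 0) (hα : k₃ * α + k₄ = 0)
    (han : ∀ p (X : TangentSpace 𝓘(ℝ, Plane) p), AnalyticAt ℂ (fun z => A z p X) α) :
    HolomorphicAcross
      (fun z => gaugeAct (fun p => gamma (L p) (L' p) ((k₁ * z + k₂) / (k₃ * z + k₄)))
        (covD (A z))) α ↔ IsParallel (covD (A α)) L' := by
  simp only [gamma_swap (L _) (L' _), inv_div]
  exact holomorphicAcross_gaugeAct_gamma_mobius_zero_iff hL' hL
    (fun p => by rw [inf_comm, hLL']) hA (fun h => hdet (by linear_combination -h)) hα han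

end Mobius

/-! ### Vectors of `ℝ³` and positive orthonormal frames -/

theorem inner_R3 (a b : R3) : inner ℝ a b = a 0 * b 0 + a 1 * b 1 + a 2 * b 2 := by
  simp [PiLp.inner_apply, Fin.sum_univ_three, mul_comm]

theorem norm_eq_one_of_inner_self {v : R3} (h : inner ℝ v v = (1 : ℝ)) : ‖v‖ = 1 := by
  rw [@norm_eq_sqrt_real_inner, h, Real.sqrt_one]

/-- The cross product of `ℝ³` as a continuous bilinear map. -/
noncomputable def crossR : R3 →L[ℝ] R3 →L[ℝ] R3 :=
  LinearMap.toContinuousBilinearMap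
    (LinearMap.mk₂ ℝ cross
      (fun u v w => by ext i; fin_cases i <;> simp [cross])
      (fun k u v => by ext i; fin_cases i <;> simp [cross])
      (fun u v w => by ext i; fin_cases i <;> simp [cross])
      (fun k u v => by ext i; fin_cases i <;> simp [cross]))

theorem crossR_apply (u v : R3) : crossR u v = cross u v := rfl

theorem cross_self_R3 (a : R3) : cross a a = 0 := by
  ext i
  simp [cross]

theorem cross_swap (a b : R3) : cross a b = -cross b a := by
  ext i
  fin_cases i <;> simp [cross, cross_apply] <;> ring

theorem cross_cross_right (a b c : R3) :
    cross a (cross b c) = (inner ℝ a c : ℝ) • b - (inner ℝ a b : ℝ) • c := by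
  ext i
  fin_cases i <;> simp [cross, cross_apply, inner_R3] <;> ring

theorem cross_cross_left (a b c : R3) :
    cross (cross a b) c = (inner ℝ a c : ℝ) • b - (inner ℝ b c : ℝ) • a := by
  rw [cross_swap, cross_cross_right, real_inner_comm a c, real_inner_comm b c, neg_sub]

theorem cross_leibniz (a b c : R3) :
    cross a (cross b c) = cross (cross a b) c + cross b (cross a c) := by
  rw [cross_cross_right, cross_cross_left, cross_cross_right, real_inner_comm b a]
  module

theorem inner_cross_left (a b : R3) : inner ℝ a (cross a b) = 0 := by
  simp only [inner_R3]
  simp [cross, cross_apply]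
  ring

theorem inner_cross_comm (a b c : R3) : inner ℝ a (cross b c) = inner ℝ (cross a b) c := by
  simp only [inner_R3]
  simp [cross, cross_apply]
  ring

theorem inner_cross_self (a b : R3) : inner ℝ (cross a b) (cross a b) =
    inner ℝ a a * inner ℝ b b - inner ℝ a b ^ 2 := by
  simp only [inner_R3]
  simp [cross, cross_apply]
  ring

theorem cross_cross_cross (n a b : R3) :
    cross (cross n a) (cross n b) = (inner ℝ n (cross a b) : ℝ) • n := by
  ext i
  fin_cases i <;> simp [cross, cross_apply, inner_R3] <;> ring

theorem cross_cross_self_of_orthogonal {n v : R3} (hn : inner ℝ n n = (1 : ℝ))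
    (hv : inner ℝ n v = (0 : ℝ)) : cross n (cross n v) = -v := by
  rw [cross_cross_right, hv, hn, zero_smul, one_smul, zero_sub]

theorem cross_quarterTurn {n a b : R3} (hn : inner ℝ n n = (1 : ℝ)) (ha : inner ℝ n a = (0 : ℝ))
    (hb : inner ℝ n b = (0 : ℝ)) : cross (cross n a) (cross n b) = cross a b := by
  have hzero : cross n (cross n (cross a b)) = 0 := by
    rw [cross_cross_right n a b, ha, hb, zero_smul, zero_smul, sub_self]
    exact map_zero (crossR n)
  rw [cross_cross_right, hn, one_smul] at hzero
  rw [cross_cross_cross, sub_eq_zero.1 hzero]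

/-- The inclusion `ℝ³ ⊆ ℂ³` as a continuous real-linear map. -/
noncomputable def cxL : R3 →L[ℝ] C3 :=
  LinearMap.toContinuousLinearMap
    { toFun := cx
      map_add' := fun x y => by ext i; simp [cx]
      map_smul' := fun k x => by ext i; simp [cx] }

theorem cx_add (a b : R3) : cx (a + b) = cx a + cx b := map_add cxL a b

theorem cx_sub (a b : R3) : cx (a - b) = cx a - cx b := map_sub cxL a b

theorem cx_smul (k : ℝ) (a : R3) : cx (k • a) = (k : ℂ) • cx a := by
  ext i
  simp [cx]

theorem cx_dotProduct (a b : R3) : cx a ⬝ᵥ cx b = ((inner ℝ a b : ℝ) : ℂ) := by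
  simp [cx, inner_R3, Matrix.vec3_dotProduct]

theorem cx_crossProduct (a b : R3) : crossProduct (cx a) (cx b) = cx (cross a b) := by
  ext i
  fin_cases i <;> simp [cx, cross, cross_apply]

theorem star_cx (a : R3) : star (cx a) = cx a := by
  ext i
  simp [cx]

theorem crossEnd_commutator (v w : C3) :
    crossEnd v * crossEnd w - crossEnd w * crossEnd v = crossEnd (crossProduct v w) := by
  ext1 u
  exact (cross_cross v w u).symm

/-- The identification of real vectors with endomorphisms of `ℂ³`, as a continuous real-linear
map. -/
noncomputable def crossEndR : R3 →L[ℝ] EndC3 :=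
  LinearMap.toContinuousLinearMap
    { toFun := fun v => crossEnd (cx v)
      map_add' := fun x y => by rw [cx_add, crossEnd_add]
      map_smul' := fun k x => by
        rw [cx_smul, crossEnd_smul, RingHom.id_apply]
        ext1 u
        exact Complex.coe_smul k _ }

theorem crossEndR_apply (v : R3) : crossEndR v = crossEnd (cx v) := rfl

/-- The vectors `n`, `t`, `w` form a positively oriented orthonormal basis of `ℝ³`. -/
structure IsOrthoFrame (n t w : R3) : Prop where
  n_n : inner ℝ n n = (1 : ℝ)
  t_t : inner ℝ t t = (1 : ℝ)
  n_t : inner ℝ n t = (0 : ℝ)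
  cross_n_t : cross n t = w

namespace IsOrthoFrame

variable {n t w : R3} (h : IsOrthoFrame n t w)
include h

theorem n_ne_zero : n ≠ 0 := fun hn => by simpa [hn] using h.n_n

theorem cross_t_w : cross t w = n := by
  rw [← h.cross_n_t, cross_cross_right, h.t_t, real_inner_comm, h.n_t]
  module

theorem cross_w_n : cross w n = t := by
  rw [← h.cross_n_t, cross_cross_left, h.n_n, real_inner_comm, h.n_t]
  module

theorem n_w : inner ℝ n w = (0 : ℝ) := by
  rw [← h.cross_n_t, inner_cross_left]

theorem t_w : inner ℝ t w = (0 : ℝ) := by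
  rw [← h.cross_n_t, cross_swap, inner_neg_right, inner_cross_left, neg_zero]

theorem w_w : inner ℝ w w = (1 : ℝ) := by
  rw [← h.cross_n_t, inner_cross_self, h.n_n, h.t_t, h.n_t]
  norm_num

theorem decomp (v : R3) :
    v = (inner ℝ n v : ℝ) • n + (inner ℝ t v : ℝ) • t + (inner ℝ w v : ℝ) • w := by
  have hperp := cross_cross_right w v w
  have hproj : cross v w = (inner ℝ t v : ℝ) • n - (inner ℝ n v : ℝ) • t := by
    rw [← h.cross_n_t, cross_cross_right, real_inner_comm, real_inner_comm v n]
  rw [hproj, ← crossR_apply, map_sub, map_smul, map_smul, crossR_apply, crossR_apply, h.cross_w_n,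
    cross_swap w t, h.cross_t_w, h.w_w, one_smul] at hperp
  linear_combination (norm := module) -hperp

theorem rotate {C S : ℝ} (hCS : C ^ 2 + S ^ 2 = 1) :
    IsOrthoFrame (C • n - S • t) (C • t + S • n) w where
  n_n := by
    simp only [inner_sub_left, inner_sub_right, real_inner_smul_left, real_inner_smul_right, h.n_n,
      h.t_t, h.n_t, real_inner_comm n t]
    linear_combination hCS
  t_t := by
    simp only [inner_add_left, inner_add_right, real_inner_smul_left, real_inner_smul_right, h.n_n,
      h.t_t, h.n_t, real_inner_comm n t]
    linear_combination hCS
  n_t := by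
    simp only [inner_sub_left, inner_add_right, real_inner_smul_left, real_inner_smul_right, h.n_n,
      h.t_t, h.n_t, real_inner_comm n t]
    ring
  cross_n_t := by
    rw [← crossR_apply]
    simp only [map_sub, map_add, map_smul, _root_.sub_apply, _root_.smul_apply, crossR_apply,
      cross_self_R3, cross_swap t n, h.cross_n_t]
    linear_combination (norm := module) hCS • w

end IsOrthoFrame

/-! ### Planes with a Lorentzian conformal structure -/

section LorentzPlane

variable {V G : Type*} [AddCommGroup V] [Module ℝ V] [AddCommGroup G] [Module ℝ G]

theorem exists_basis_eigenvectors_of_involution (hV : Module.finrank ℝ V = 2)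
    (g : V →ₗ[ℝ] V →ₗ[ℝ] ℝ) (J : V →ₗ[ℝ] V) (hpos : ∃ X, 0 < g X X) (hJ : ∀ X, J (J X) = X)
    (hgJ : ∀ X Y, g (J X) Y = -g X (J Y)) :
    ∃ b : Module.Basis (Fin 2) ℝ V, J (b 0) = b 0 ∧ J (b 1) = -b 1 := by
  obtain ⟨X₀, hX₀⟩ := hpos
  obtain ⟨X, hX⟩ : ∃ X, J X ≠ X := by
    by_contra! h
    have := hgJ X₀ X₀
    rw [h] at this
    linarith
  obtain ⟨Y, hY⟩ : ∃ Y, J Y ≠ -Y := by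
    by_contra! h
    have := hgJ X₀ X₀
    rw [h, map_neg, map_neg, LinearMap.neg_apply] at this
    linarith
  have hplus : J (Y + J Y) = Y + J Y := by rw [map_add, hJ, add_comm]
  have hminus : J (X - J X) = -(X - J X) := by rw [map_sub, hJ, neg_sub]
  have hplus_ne : Y + J Y ≠ 0 := fun h => hY (eq_neg_of_add_eq_zero_right h)
  have hminus_ne : X - J X ≠ 0 := fun h => hX (sub_eq_zero.1 h).symm
  have hli : LinearIndependent ℝ ![Y + J Y, X - J X] := by
    rw [LinearIndependent.pair_iff' hplus_ne]
    intro k hk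
    have hJk := congrArg J hk
    rw [map_smul, hplus, hk, hminus] at hJk
    exact hminus_ne (by linear_combination (norm := module) (1 / 2 : ℝ) • hJk)
  refine ⟨basisOfLinearIndependentOfCardEqFinrank hli (by simp [hV]), ?_, ?_⟩
  · simpa using hplus
  · simpa using hminus

theorem apply_eq_smul_of_isAlt (b : Module.Basis (Fin 2) ℝ V) {B : V →ₗ[ℝ] V →ₗ[ℝ] G}
    (hB : B.IsAlt) (X Y : V) :
    B X Y = (b.repr X 0 * b.repr Y 1 - b.repr X 1 * b.repr Y 0) • B (b 0) (b 1) := by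
  conv_lhs => rw [← b.sum_repr X, ← b.sum_repr Y]
  simp only [Fin.sum_univ_two, map_add, map_smul, LinearMap.add_apply, LinearMap.smul_apply,
    hB.self_eq_zero, ← hB.neg (b 0) (b 1)]
  module

theorem apply_apply_of_isAlt (b : Module.Basis (Fin 2) ℝ V) {B : V →ₗ[ℝ] V →ₗ[ℝ] G}
    (hB : B.IsAlt) (S : V →ₗ[ℝ] V) (X Y : V) : B (S X) (S Y) = LinearMap.det S • B X Y := by
  have hS (X : V) (i : Fin 2) : b.repr (S X) i =
      b.repr X 0 * b.repr (S (b 0)) i + b.repr X 1 * b.repr (S (b 1)) i := by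
    conv_lhs => rw [← b.sum_repr X, Fin.sum_univ_two, map_add, map_smul, map_smul, map_add,
      map_smul, map_smul, Finsupp.add_apply, Finsupp.smul_apply, Finsupp.smul_apply]
    rfl
  rw [apply_eq_smul_of_isAlt b hB (S X), apply_eq_smul_of_isAlt b hB X, smul_smul,
    ← LinearMap.det_toMatrix b, Matrix.det_fin_two]
  simp only [hS X, hS Y, LinearMap.toMatrix_apply]
  ring_nf

variable {b : Module.Basis (Fin 2) ℝ V} {J : V →ₗ[ℝ] V} (h0 : J (b 0) = b 0) (h1 : J (b 1) = -b 1)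
include h0 h1

theorem apply_involution_comm_of_isAlt {B : V →ₗ[ℝ] V →ₗ[ℝ] G} (hB : B.IsAlt) (X Y : V) :
    B X (J Y) = B Y (J X) := by
  rw [← b.sum_repr X, ← b.sum_repr Y]
  simp only [Fin.sum_univ_two, map_add, map_smul, h0, h1, LinearMap.add_apply,
    LinearMap.smul_apply, hB.self_eq_zero, map_neg, ← hB.neg (b 0) (b 1)]
  module

theorem exists_eq_mul_of_isAlt {g : V →ₗ[ℝ] V →ₗ[ℝ] ℝ} (hsymm : ∀ X Y, g X Y = g Y X)
    (hpos : ∃ X, 0 < g X X) (hgJ : ∀ X Y, g (J X) Y = -g X (J Y))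
    {B : V →ₗ[ℝ] V →ₗ[ℝ] ℝ} (hB : B.IsAlt) : ∃ k : ℝ, ∀ X Y, B (J X) Y = k * g X Y := by
  have g0 : g (b 0) (b 0) = 0 := by
    have := hgJ (b 0) (b 0)
    rw [h0] at this
    linarith
  have g1 : g (b 1) (b 1) = 0 := by
    have := hgJ (b 1) (b 1)
    rw [h1, map_neg, map_neg, LinearMap.neg_apply] at this
    linarith
  have g01 : g (b 0) (b 1) ≠ 0 := by
    intro h
    obtain ⟨X, hX⟩ := hpos
    rw [← b.sum_repr X] at hX
    simp only [Fin.sum_univ_two, map_add, map_smul, LinearMap.add_apply, LinearMap.smul_apply,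
      g0, g1, h, hsymm (b 1) (b 0), smul_zero, add_zero, lt_irrefl] at hX
  refine ⟨B (b 0) (b 1) / g (b 0) (b 1), fun X Y => ?_⟩
  rw [← b.sum_repr X, ← b.sum_repr Y]
  simp only [Fin.sum_univ_two, map_add, map_smul, h0, h1, LinearMap.add_apply,
    LinearMap.smul_apply, hB.self_eq_zero, map_neg, ← hB.neg (b 0) (b 1), g0, g1, hsymm (b 1) (b 0),
    LinearMap.neg_apply, smul_eq_mul]
  field_simp
  ring

end LorentzPlane

/-- The pullback of the cross product of `ℝ³` by a linear map. -/
noncomputable def crossForm {V : Type*} [AddCommGroup V] [Module ℝ V] (A : V →ₗ[ℝ] R3) :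
    V →ₗ[ℝ] V →ₗ[ℝ] R3 :=
  crossR.toLinearMap₁₂.compl₁₂ A A

theorem isAlt_crossForm {V : Type*} [AddCommGroup V] [Module ℝ V] (A : V →ₗ[ℝ] R3) :
    (crossForm A).IsAlt := fun X => cross_self_R3 (A X)

namespace LorentzConformalStructure

variable {M : Type*} [TopologicalSpace M] [ChartedSpace Plane M]
variable (c : LorentzConformalStructure M) (p : M)

theorem exists_basis_eigenvectors_hodge :
    ∃ b : Module.Basis (Fin 2) ℝ (TangentSpace 𝓘(ℝ, Plane) p),
      (c.hodge p).toLinearMap (b 0) = b 0 ∧ (c.hodge p).toLinearMap (b 1) = -b 1 :=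
  exists_basis_eigenvectors_of_involution (finrank_euclideanSpace_fin (𝕜 := ℝ) (n := 2))
    (c.metric p).toLinearMap₁₂ (c.hodge p).toLinearMap (c.exists_pos p) (c.hodge_hodge p)
    (c.metric_hodge p)

theorem exists_eq_mul_metric_of_isAlt
    {B : TangentSpace 𝓘(ℝ, Plane) p →ₗ[ℝ] TangentSpace 𝓘(ℝ, Plane) p →ₗ[ℝ] ℝ} (hB : B.IsAlt) :
    ∃ k : ℝ, ∀ X Y, B (c.hodge p X) Y = k * c.metric p X Y := by
  obtain ⟨b, h0, h1⟩ := c.exists_basis_eigenvectors_hodge p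
  exact exists_eq_mul_of_isAlt h0 h1 (g := (c.metric p).toLinearMap₁₂) (c.symm p) (c.exists_pos p)
    (c.metric_hodge p) hB

variable {p}
variable (A : TangentSpace 𝓘(ℝ, Plane) p →L[ℝ] R3) (X Y : TangentSpace 𝓘(ℝ, Plane) p)

theorem cross_hodge_comm :
    cross (A X) (A (c.hodge p Y)) = cross (A Y) (A (c.hodge p X)) := by
  obtain ⟨b, h0, h1⟩ := c.exists_basis_eigenvectors_hodge p
  exact apply_involution_comm_of_isAlt h0 h1 (isAlt_crossForm A.toLinearMap) X Y

theorem cross_hodge_hodge :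
    cross (A (c.hodge p X)) (A (c.hodge p Y)) = -cross (A X) (A Y) := by
  rw [c.cross_hodge_comm, c.hodge_hodge, cross_swap]

end LorentzConformalStructure

/-! ### Harmonic maps to the sphere -/

section Harmonic

variable {M : Type*} [TopologicalSpace M] [ChartedSpace Plane M]

theorem dmap_inner {f g : M → R3} {p : M} (hf : MDifferentiableAt 𝓘(ℝ, Plane) 𝓘(ℝ, R3) f p)
    (hg : MDifferentiableAt 𝓘(ℝ, Plane) 𝓘(ℝ, R3) g p) (X : TangentSpace 𝓘(ℝ, Plane) p) :
    dmap (fun q => (inner ℝ (f q) (g q) : ℝ)) p X =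
      (inner ℝ (f p) (dmap g p X) + inner ℝ (dmap f p X) (g p) : ℝ) :=
  dmap_bilin (innerSL ℝ : R3 →L[ℝ] R3 →L[ℝ] ℝ) hf hg X

theorem inner_dmap_add_inner_dmap_of_inner_eq {f g : M → R3} {p : M}
    (hf : MDifferentiableAt 𝓘(ℝ, Plane) 𝓘(ℝ, R3) f p)
    (hg : MDifferentiableAt 𝓘(ℝ, Plane) 𝓘(ℝ, R3) g p) {k : ℝ}
    (h : ∀ q, inner ℝ (f q) (g q) = k) (X : TangentSpace 𝓘(ℝ, Plane) p) :
    inner ℝ (f p) (dmap g p X) + inner ℝ (g p) (dmap f p X) = 0 := by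
  rw [real_inner_comm (dmap f p X), ← dmap_inner hf hg, funext h, dmap_const, _root_.zero_apply]

/-- The bilinear map `(n, v) ↦ (u ↦ (n × v) × u)`. -/
noncomputable def crossCrossB : R3 →L[ℝ] R3 →L[ℝ] EndC3 :=
  (ContinuousLinearMap.compL ℝ R3 R3 EndC3 crossEndR).comp crossR

theorem crossCrossB_apply (n v : R3) : crossCrossB n v = crossEnd (cx (cross n v)) := rfl

theorem offDiag_eq_bilinForm (N : M → R3) : offDiag N = bilinForm crossCrossB N (dmap N) := rfl

theorem hodgeStar_offDiag_eq_bilinForm (c : LorentzConformalStructure M) (N : M → R3) :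
    hodgeStar c (offDiag N) = bilinForm crossCrossB N (hodgeStar c (dmap N)) := rfl

theorem assocForm_eq (c : LorentzConformalStructure M) (N : M → R3) (z : ℂ) :
    assocForm c N z = fun p =>
      (((z + z⁻¹) / 2 - 1) • ContinuousLinearMap.id ℝ EndC3).comp (offDiag N p)
      + (((z - z⁻¹) / 2) • ContinuousLinearMap.id ℝ EndC3).comp (hodgeStar c (offDiag N) p) := by
  funext p
  ext1 X
  change -offDiag N p X + z • (1 / 2 : ℂ) • (offDiag N p X + hodgeStar c (offDiag N) p X)
      + z⁻¹ • (1 / 2 : ℂ) • (offDiag N p X - hodgeStar c (offDiag N) p X)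
    = ((z + z⁻¹) / 2 - 1) • offDiag N p X + ((z - z⁻¹) / 2) • hodgeStar c (offDiag N) p X
  module

theorem assocForm_apply (c : LorentzConformalStructure M) (N : M → R3) (z : ℂ) (p : M)
    (X : TangentSpace 𝓘(ℝ, Plane) p) : assocForm c N z p X =
      crossEnd (((z + z⁻¹) / 2 - 1) • cx (cross (N p) (dmap N p X)) +
        ((z - z⁻¹) / 2) • cx (cross (N p) (dmap N p (c.hodge p X)))) := by
  rw [assocForm_eq, crossEnd_add, crossEnd_smul, crossEnd_smul]
  rfl

namespace IsHarmonic

variable {c : LorentzConformalStructure M} {N : M → R3} (h : IsHarmonic c N) (p : M)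
  (X Y : TangentSpace 𝓘(ℝ, Plane) p)
include h

theorem mdifferentiableAt : MDifferentiableAt 𝓘(ℝ, Plane) 𝓘(ℝ, R3) N p :=
  h.smooth.mdifferentiable (by simp) p

theorem inner_self : inner ℝ (N p) (N p) = (1 : ℝ) := by
  rw [real_inner_self_eq_norm_sq, h.unit, one_pow]

theorem inner_dmap : inner ℝ (N p) (dmap N p X) = (0 : ℝ) := by
  have := inner_dmap_add_inner_dmap_of_inner_eq (h.mdifferentiableAt p) (h.mdifferentiableAt p)
    h.inner_self X
  linarith

theorem assocForm_commutator {z : ℂ} (hz : z ≠ 0) :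
    assocForm c N z p X * assocForm c N z p Y - assocForm c N z p Y * assocForm c N z p X =
      (2 - (z + z⁻¹)) • crossEnd (cx (cross (dmap N p X) (dmap N p Y))) := by
  have hquarter (X Y : TangentSpace 𝓘(ℝ, Plane) p) :
      cross (cross (N p) (dmap N p X)) (cross (N p) (dmap N p Y)) =
        cross (dmap N p X) (dmap N p Y) :=
    cross_quarterTurn (h.inner_self p) (h.inner_dmap p X) (h.inner_dmap p Y)
  have hmixed : cross (dmap N p (c.hodge p X)) (dmap N p Y) =
      -cross (dmap N p X) (dmap N p (c.hodge p Y)) := by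
    rw [cross_swap, c.cross_hodge_comm]
  have hneg (v : R3) : cx (-v) = -cx v := map_neg cxL v
  have hsq : ((z + z⁻¹) / 2) ^ 2 - ((z - z⁻¹) / 2) ^ 2 = 1 := by field_simp; ring
  rw [assocForm_apply, assocForm_apply, crossEnd_commutator, ← crossEnd_smul]
  simp only [map_add, map_smul, LinearMap.add_apply, LinearMap.smul_apply, cx_crossProduct,
    hquarter, c.cross_hodge_hodge, hmixed, hneg]
  congr 1
  linear_combination (norm := module) hsq • cx (cross (dmap N p X) (dmap N p Y))

variable [IsManifold 𝓘(ℝ, Plane) ∞ M]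

theorem formDiffAt_offDiag : FormDiffAt (offDiag N) p :=
  formDiffAt_bilinForm crossCrossB (h.mdifferentiableAt p) (formDiffAt_dmap h.smooth p)

theorem extD_offDiag :
    extD (offDiag N) p X Y = (2 : ℂ) • crossEnd (cx (cross (dmap N p X) (dmap N p Y))) := by
  rw [offDiag_eq_bilinForm, extD_bilinForm _ (h.mdifferentiableAt p) (formDiffAt_dmap h.smooth p),
    extD_dmap h.smooth, map_zero, add_zero, crossCrossB_apply, crossCrossB_apply,
    cross_swap (dmap N p Y), ← crossEndR_apply, ← crossEndR_apply, map_neg]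
  module

theorem extD_hodgeStar_offDiag : extD (hodgeStar c (offDiag N)) p X Y = 0 := by
  rw [hodgeStar_offDiag_eq_bilinForm, extD_bilinForm _ (h.mdifferentiableAt p)
    (formDiffAt_hodgeStar c (formDiffAt_dmap h.smooth p)), crossCrossB_apply, crossCrossB_apply,
    crossCrossB_apply, h.tension, ← crossEndR_apply, ← crossEndR_apply, ← crossEndR_apply,
    map_zero, add_zero, sub_eq_zero]
  exact congrArg crossEndR (c.cross_hodge_comm (dmap N p) X Y)

theorem extD_assocForm (z : ℂ) : extD (assocForm c N z) p X Y =
    (z + z⁻¹ - 2) • crossEnd (cx (cross (dmap N p X) (dmap N p Y))) := by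
  have hoff := h.formDiffAt_offDiag p
  have hstar := formDiffAt_hodgeStar c hoff
  rw [assocForm_eq, extD_add (hoff.clm _) (hstar.clm _), extD_clm hoff, extD_clm hstar,
    h.extD_hodgeStar_offDiag, map_zero, add_zero, h.extD_offDiag]
  change ((z + z⁻¹) / 2 - 1) • (2 : ℂ) • crossEnd (cx (cross (dmap N p X) (dmap N p Y))) = _
  module

theorem isFlat_assocForm {z : ℂ} (hz : z ≠ 0) : IsFlat (assocForm c N z) := by
  intro p X Y
  rw [h.extD_assocForm, h.assocForm_commutator p X Y hz]
  module

end IsHarmonic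

theorem extD_cross_hodgeStar [IsManifold 𝓘(ℝ, Plane) ∞ M] (c : LorentzConformalStructure M)
    {N : M → R3} (hN : ContMDiff 𝓘(ℝ, Plane) 𝓘(ℝ, R3) ∞ N) (p : M)
    (X Y : TangentSpace 𝓘(ℝ, Plane) p) :
    extD (bilinForm crossR N (hodgeStar c (dmap N))) p X Y =
      cross (N p) (extD (hodgeStar c (dmap N)) p X Y) := by
  rw [extD_bilinForm crossR (hN.mdifferentiable (by simp) p)
    (formDiffAt_hodgeStar c (formDiffAt_dmap hN p))]
  change cross _ (dmap N p (c.hodge p Y)) - cross _ (dmap N p (c.hodge p X)) + _ = _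
  rw [c.cross_hodge_comm (dmap N p) X Y, sub_self, zero_add]
  rfl

end Harmonic

/-! ### Surfaces with prescribed Gauss map -/

section Surface

variable {M : Type*} [TopologicalSpace M] [ChartedSpace Plane M]
variable {c : LorentzConformalStructure M} {N f : M → R3} {p : M}

theorem ImmersesAt.exists_dmap_eq (himm : ImmersesAt f p) {n : R3} (hn : n ≠ 0)
    (horth : ∀ X, inner ℝ n (dmap f p X) = (0 : ℝ)) {v : R3} (hv : inner ℝ n v = (0 : ℝ)) :
    ∃ X, dmap f p X = v := by
  let F : Plane →ₗ[ℝ] R3 := (dmap f p).toLinearMap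
  have : Fact (Module.finrank ℝ R3 = 2 + 1) := ⟨finrank_euclideanSpace_fin⟩
  have hle : LinearMap.range F ≤ (Submodule.span ℝ {n})ᗮ := by
    rintro _ ⟨X, rfl⟩
    exact Submodule.mem_orthogonal_singleton_iff_inner_right.2 (horth X)
  have hrank : Module.finrank ℝ (LinearMap.range F) = 2 :=
    (LinearMap.finrank_range_of_inj himm).trans finrank_euclideanSpace_fin
  have heq : LinearMap.range F = (Submodule.span ℝ {n})ᗮ := Submodule.eq_of_le_of_finrank_eq hle
    (hrank.trans (Submodule.finrank_orthogonal_span_singleton hn).symm)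
  exact LinearMap.mem_range.1
    (heq ▸ Submodule.mem_orthogonal_singleton_iff_inner_right.2 hv : v ∈ LinearMap.range F)

theorem SecondFormSpansAt.secondForm_self_eq_zero_iff {f' N' : M → R3}
    (h : SecondFormSpansAt c f N p) (h' : SecondFormSpansAt c f' N' p)
    (X : TangentSpace 𝓘(ℝ, Plane) p) : secondForm f' N' p X X = 0 ↔ secondForm f N p X X = 0 := by
  obtain ⟨k, hk, hII⟩ := h
  obtain ⟨k', hk', hII'⟩ := h'
  rw [hII, hII', mul_eq_zero_iff_left hk, mul_eq_zero_iff_left hk']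

namespace IsPotentialAt

variable (hf : IsPotentialAt c N f p)
include hf

theorem inner_dmap (X : TangentSpace 𝓘(ℝ, Plane) p) : inner ℝ (N p) (dmap f p X) = (0 : ℝ) := by
  rw [hf X, inner_cross_left]

theorem secondForm_eq (X Y : TangentSpace 𝓘(ℝ, Plane) p) : secondForm f N p X Y =
    -inner ℝ (N p) (cross (dmap N p (c.hodge p X)) (dmap N p Y)) := by
  rw [secondForm, hf X, inner_cross_comm]
  rfl

theorem dmap_gaussMap_ne_zero (himm : ImmersesAt f p) {X : TangentSpace 𝓘(ℝ, Plane) p}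
    (hX : X ≠ 0) : dmap N p X ≠ 0 := by
  intro hzero
  have hJX : c.hodge p X ≠ 0 := fun h => hX (by rw [← c.hodge_hodge p X, h, map_zero])
  have hdf : dmap f p (c.hodge p X) = 0 := by
    rw [hf, hodgeStar, ContinuousLinearMap.comp_apply, c.hodge_hodge, hzero]
    exact map_zero (crossR (N p))
  exact hJX (himm (hdf.trans (map_zero _).symm))

variable (hunit : inner ℝ (N p) (N p) = (1 : ℝ))
  (horth : ∀ X, inner ℝ (N p) (dmap N p X) = (0 : ℝ))
include hunit horth

theorem exists_secondForm_ne_zero (himm : ImmersesAt f p) : ∃ X Y, secondForm f N p X Y ≠ 0 := by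
  have hN : N p ≠ 0 := fun h => by simp [h] at hunit
  obtain ⟨X, hX⟩ := c.exists_pos p
  have hX0 : X ≠ 0 := fun h => by simp [h] at hX
  obtain ⟨Y, hY⟩ := himm.exists_dmap_eq hN hf.inner_dmap (horth X)
  refine ⟨Y, X, ?_⟩
  rw [secondForm, hY, neg_ne_zero]
  exact inner_self_ne_zero.2 (hf.dmap_gaussMap_ne_zero himm hX0)

theorem secondFormSpansAt (himm : ImmersesAt f p) : SecondFormSpansAt c f N p := by
  let B := (crossForm (dmap N p).toLinearMap).compr₂ (-(innerₗ R3 (N p)))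
  have hB : B.IsAlt := fun X => by
    change -inner ℝ (N p) (crossForm (dmap N p).toLinearMap X X) = (0 : ℝ)
    rw [isAlt_crossForm, inner_zero_right, neg_zero]
  obtain ⟨k, hk⟩ := c.exists_eq_mul_metric_of_isAlt p hB
  have hII (X Y : TangentSpace 𝓘(ℝ, Plane) p) : secondForm f N p X Y = k * c.metric p X Y :=
    (hf.secondForm_eq X Y).trans (hk X Y)
  obtain ⟨X, Y, hXY⟩ := hf.exists_secondForm_ne_zero hunit horth himm
  exact ⟨k, left_ne_zero_of_mul (hII X Y ▸ hXY), hII⟩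

theorem dmap_hodge_shape {S : TangentSpace 𝓘(ℝ, Plane) p →ₗ[ℝ] TangentSpace 𝓘(ℝ, Plane) p}
    (hS : ∀ X, dmap f p (S X) = -dmap N p X) (X : TangentSpace 𝓘(ℝ, Plane) p) :
    dmap N p (c.hodge p (S X)) = cross (N p) (dmap N p X) := by
  have hdf : cross (N p) (dmap N p (c.hodge p (S X))) = -dmap N p X := by rw [← hS X, hf]; rfl
  have h := congrArg (crossR (N p)) hdf
  rw [map_neg, crossR_apply, crossR_apply, cross_cross_self_of_orthogonal hunit (horth _)] at h
  exact neg_injective h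

theorem det_shape (himm : ImmersesAt f p)
    {S : TangentSpace 𝓘(ℝ, Plane) p →ₗ[ℝ] TangentSpace 𝓘(ℝ, Plane) p}
    (hS : ∀ X, dmap f p (S X) = -dmap N p X) : LinearMap.det S = -1 := by
  obtain ⟨b, -, -⟩ := c.exists_basis_eigenvectors_hodge p
  obtain ⟨X, Y, hXY⟩ := hf.exists_secondForm_ne_zero hunit horth himm
  have hB : cross (dmap N p (c.hodge p X)) (dmap N p Y) ≠ 0 := fun h => by
    rw [hf.secondForm_eq, h, inner_zero_right, neg_zero] at hXY
    exact hXY rfl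
  have hdet := apply_apply_of_isAlt b (isAlt_crossForm (dmap N p).toLinearMap) S (c.hodge p X) Y
  change cross (dmap N p (S _)) (dmap N p (S _)) = _ • cross (dmap N p _) (dmap N p _) at hdet
  rw [← neg_neg (cross (dmap N p (S _)) _), ← c.cross_hodge_hodge,
    hf.dmap_hodge_shape hunit horth hS, hf.dmap_hodge_shape hunit horth hS,
    cross_quarterTurn hunit (horth _) (horth _)] at hdet
  refine smul_left_injective ℝ hB ?_
  change LinearMap.det S • _ = (-1 : ℝ) • _
  rw [← hdet, neg_one_smul]

theorem hasGaussMapAndCurvatureAt (himm : ImmersesAt f p) :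
    HasGaussMapAndCurvatureAt f N p (-1) := by
  have hN : N p ≠ 0 := fun h => by simp [h] at hunit
  let F : Plane →ₗ[ℝ] R3 := (dmap f p).toLinearMap
  obtain ⟨G, hG⟩ := F.exists_leftInverse_of_injective (LinearMap.ker_eq_bot.2 himm)
  let S := -(G ∘ₗ (dmap N p).toLinearMap)
  have hS (X : TangentSpace 𝓘(ℝ, Plane) p) : dmap f p (S X) = -dmap N p X := by
    obtain ⟨Y, hY⟩ := himm.exists_dmap_eq hN hf.inner_dmap (horth X)
    have hGY : G (dmap N p X) = Y := hY ▸ LinearMap.congr_fun hG Y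
    change dmap f p (-G (dmap N p X)) = _
    rw [hGY, ← hY]
    exact map_neg (dmap f p) Y
  exact ⟨himm, norm_eq_one_of_inner_self hunit, hf.inner_dmap, S, hS,
    hf.det_shape hunit horth himm hS⟩

end IsPotentialAt

theorem IsHarmonic.hasGaussMapAndCurvatureAt_and_secondFormSpansAt (hN : IsHarmonic c N)
    (hf : IsPotentialAt c N f p) (himm : ImmersesAt f p) :
    HasGaussMapAndCurvatureAt f N p (-1) ∧ SecondFormSpansAt c f N p :=
  ⟨hf.hasGaussMapAndCurvatureAt (hN.inner_self p) (hN.inner_dmap p) himm,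
    hf.secondFormSpansAt (hN.inner_self p) (hN.inner_dmap p) himm⟩

end Surface

/-! ### Null lines reflected to their conjugates -/

theorem conjLine_span (u : C3) : conjLine (Submodule.span ℂ {u}) = Submodule.span ℂ {star u} := by
  ext v
  change star v ∈ Submodule.span ℂ {u} ↔ _
  rw [Submodule.mem_span_singleton, Submodule.mem_span_singleton]
  constructor
  · rintro ⟨k, hk⟩
    exact ⟨star k, by rw [← star_smul, hk, star_star]⟩
  · rintro ⟨k, rfl⟩
    exact ⟨star k, by rw [star_smul, star_star]⟩

/-- The imaginary part of a vector of `ℂ³`. -/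
noncomputable def imL : C3 →L[ℝ] R3 :=
  LinearMap.toContinuousLinearMap
    { toFun := fun v => WithLp.toLp 2 fun i => (v i).im
      map_add' := fun x y => by ext i; simp
      map_smul' := fun k x => by ext i; simp }

theorem eq_cx_add_I_smul_imL {u : C3} {n : R3} (h : u + star u = (2 : ℂ) • cx n) :
    u = cx n + Complex.I • cx (imL u) := by
  ext i
  have hi := congrFun h i
  have hre : u i + star (u i) = 2 * (u i).re := by
    rw [Complex.star_def, Complex.add_conj, Complex.ofReal_mul, Complex.ofReal_ofNat]
  rw [Pi.add_apply, Pi.star_apply, hre] at hi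
  calc u i = (u i).re + Complex.I * (u i).im := by rw [mul_comm, Complex.re_add_im]
    _ = (cx n + Complex.I • cx (imL u)) i := by rw [mul_left_cancel₀ two_ne_zero hi]; rfl

section Reflection

variable {n : R3} {l : Submodule ℂ C3} (hrefl : l.map (reflC n) = conjLine l) {u : C3} (hu : u ∈ l)
include hrefl hu

theorem eq_zero_of_dotProduct_cx_eq_zero (hinf : l ⊓ conjLine l = ⊥) (hun : u ⬝ᵥ cx n = 0) :
    u = 0 := by
  have hfix : reflC n u = u := by
    change u - (2 * (u ⬝ᵥ cx n)) • cx n = u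
    rw [hun, mul_zero, zero_smul, sub_zero]
  have hconj : u ∈ conjLine l := by
    rw [← hfix, ← hrefl]
    exact Submodule.mem_map_of_mem hu
  rw [← Submodule.mem_bot ℂ, ← hinf]
  exact ⟨hu, hconj⟩

theorem add_star_eq_two_smul_cx (hl : l = Submodule.span ℂ {u}) (hn : inner ℝ n n = (1 : ℝ))
    (hun : u ⬝ᵥ cx n = 1) : u + star u = (2 : ℂ) • cx n := by
  have hmem : reflC n u ∈ conjLine l := hrefl ▸ Submodule.mem_map_of_mem hu
  rw [hl, conjLine_span, Submodule.mem_span_singleton] at hmem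
  obtain ⟨k, hk⟩ := hmem
  replace hk : k • star u = u - (2 : ℂ) • cx n := by
    rw [hk]
    change u - (2 * (u ⬝ᵥ cx n)) • cx n = _
    rw [hun, mul_one]
  have hstar : star u ⬝ᵥ cx n = 1 := by
    rw [← star_cx n, Matrix.star_dotProduct_star, dotProduct_comm, hun, star_one]
  have hk1 : k = -1 := by
    have hdot := congrArg (· ⬝ᵥ cx n) hk
    simp only [smul_dotProduct, sub_dotProduct, hun, hstar, cx_dotProduct, hn, smul_eq_mul] at hdot
    push_cast at hdot
    linear_combination hdot
  rw [hk1] at hk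
  linear_combination (norm := module) -hk

end Reflection

theorem isOrthoFrame_of_null {n t : R3} (hn : inner ℝ n n = (1 : ℝ))
    (h : (cx n + Complex.I • cx t) ⬝ᵥ (cx n + Complex.I • cx t) = 0) :
    IsOrthoFrame n t (cross n t) := by
  simp only [add_dotProduct, dotProduct_add, smul_dotProduct, dotProduct_smul, cx_dotProduct, hn,
    real_inner_comm n t, smul_eq_mul] at h
  have hsplit : ((1 - inner ℝ t t : ℝ) : ℂ) + ((2 * inner ℝ n t : ℝ) : ℂ) * Complex.I = 0 := by
    push_cast at h ⊢
    linear_combination h - (inner ℝ t t : ℝ) * Complex.I_sq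
  rw [← Complex.mk_eq_add_mul_I] at hsplit
  have hre : 1 - inner ℝ t t = (0 : ℝ) := congrArg Complex.re hsplit
  have him : 2 * inner ℝ n t = (0 : ℝ) := congrArg Complex.im hsplit
  exact ⟨hn, by linarith, by linarith, rfl⟩

namespace IsOrthoFrame

variable {n t w : R3} (h : IsOrthoFrame n t w)
include h

theorem isHyperbolicPair : IsHyperbolicPair (cx n + Complex.I • cx t)
    ((1 / 2 : ℂ) • (cx n - Complex.I • cx t)) := by
  constructor <;>
  · simp only [add_dotProduct, dotProduct_add, sub_dotProduct, dotProduct_sub, smul_dotProduct,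
      dotProduct_smul, cx_dotProduct, h.n_n, h.t_t, h.n_t, real_inner_comm n t, smul_eq_mul]
    push_cast
    ring_nf
    norm_num [Complex.I_sq]

end IsOrthoFrame

section NullBundle

variable {M : Type*} [TopologicalSpace M] [ChartedSpace Plane M]

theorem contMDiffAt_cx {f : M → R3} {p : M} (hf : ContMDiffAt 𝓘(ℝ, Plane) 𝓘(ℝ, R3) ∞ f p) :
    ContMDiffAt 𝓘(ℝ, Plane) 𝓘(ℝ, C3) ∞ (fun q => cx (f q)) p :=
  contMDiffAt_clm cxL hf

theorem eq_of_span_eq_of_dotProduct_eq_one {u v e : C3}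
    (h : Submodule.span ℂ {u} = Submodule.span ℂ {v}) (hu : u ⬝ᵥ e = 1) (hv : v ⬝ᵥ e = 1) :
    u = v := by
  have hmem : u ∈ Submodule.span ℂ {v} := h ▸ Submodule.mem_span_singleton_self u
  obtain ⟨k, rfl⟩ := Submodule.mem_span_singleton.1 hmem
  rw [smul_dotProduct, hv, smul_eq_mul, mul_one] at hu
  rw [hu, one_smul]

theorem IsNullLineSubbundle.exists_normalized_section {L : M → Submodule ℂ C3}
    (hL : IsNullLineSubbundle L) {e : M → C3} (he : ContMDiff 𝓘(ℝ, Plane) 𝓘(ℝ, C3) ∞ e)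
    (hLe : ∀ p, ∀ v ∈ L p, v ⬝ᵥ e p = 0 → v = 0) :
    ∃ u : M → C3, ContMDiff 𝓘(ℝ, Plane) 𝓘(ℝ, C3) ∞ u ∧
      ∀ p, L p = Submodule.span ℂ {u p} ∧ u p ⬝ᵥ e p = 1 := by
  have hlocal (p : M) : ∃ u : M → C3, ContMDiffAt 𝓘(ℝ, Plane) 𝓘(ℝ, C3) ∞ u p ∧
      ∀ᶠ q in 𝓝 p, L q = Submodule.span ℂ {u q} ∧ u q ⬝ᵥ e q = 1 := by
    obtain ⟨s, hs, hsL⟩ := hL.exists_local_section p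
    have hne : ∀ᶠ q in 𝓝 p, s q ⬝ᵥ e q ≠ 0 := hsL.mono fun q hq hz =>
      hq.1 (hLe q (s q) (hq.2.2 ▸ Submodule.mem_span_singleton_self _) hz)
    refine ⟨fun q => (s q ⬝ᵥ e q)⁻¹ • s q, contMDiffAt_bilin smulB
      (contMDiffAt_inv (contMDiffAt_dotProduct hs (he p)) hne.self_of_nhds) hs, ?_⟩
    filter_upwards [hsL, hne] with q hq hq'
    rw [hq.2.2, Submodule.span_singleton_smul_eq (inv_ne_zero hq').isUnit, smul_dotProduct,
      smul_eq_mul, inv_mul_cancel₀ hq']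
    exact ⟨rfl, rfl⟩
  choose u hus hu using hlocal
  refine ⟨fun p => u p p, fun p => (hus p).congr_of_eventuallyEq ?_, fun p => (hu p).self_of_nhds⟩
  filter_upwards [hu p] with q hq
  exact eq_of_span_eq_of_dotProduct_eq_one ((hu q).self_of_nhds.1.symm.trans hq.1)
    (hu q).self_of_nhds.2 hq.2

theorem IsNullLineSubbundle.exists_tangent {L : M → Submodule ℂ C3} (hL : IsNullLineSubbundle L)
    {N : M → R3} (hN : ContMDiff 𝓘(ℝ, Plane) 𝓘(ℝ, R3) ∞ N)
    (hunit : ∀ p, inner ℝ (N p) (N p) = (1 : ℝ))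
    (hrefl : ∀ p, (L p).map (reflC (N p)) = conjLine (L p))
    (hinf : ∀ p, L p ⊓ conjLine (L p) = ⊥) :
    ∃ t : M → R3, ContMDiff 𝓘(ℝ, Plane) 𝓘(ℝ, R3) ∞ t ∧
      ∀ p, IsOrthoFrame (N p) (t p) (cross (N p) (t p)) ∧
        L p = Submodule.span ℂ {cx (N p) + Complex.I • cx (t p)} := by
  obtain ⟨u, hus, hu⟩ := hL.exists_normalized_section (fun p => contMDiffAt_cx (hN p))
    fun p v hv => eq_zero_of_dotProduct_cx_eq_zero (hrefl p) hv (hinf p)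
  have hmem (p : M) : u p ∈ L p := (hu p).1 ▸ Submodule.mem_span_singleton_self _
  have hdecomp (p : M) : u p = cx (N p) + Complex.I • cx (imL (u p)) :=
    eq_cx_add_I_smul_imL
      (add_star_eq_two_smul_cx (hrefl p) (hmem p) (hu p).1 (hunit p) (hu p).2)
  refine ⟨fun p => imL (u p), fun p => contMDiffAt_clm imL (hus p), fun p => ⟨?_, ?_⟩⟩
  · exact isOrthoFrame_of_null (hunit p) (hdecomp p ▸ hL.null p _ (hmem p))
  · exact hdecomp p ▸ (hu p).1

end NullBundle

/-! ### Gauging by a parallel `Γ` -/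

section ParallelFrame

variable {M : Type*} [TopologicalSpace M] [ChartedSpace Plane M]

namespace IsLocalHyperbolicFrame

variable {L L' : M → Submodule ℂ C3} {u w : M → C3} {p : M}
  (hF : IsLocalHyperbolicFrame L L' u w p) {A A₀ A' : ConnForm M} (hA₀ : IsMetricConn A₀)
  {X : TangentSpace 𝓘(ℝ, Plane) p} (hu : covD A₀ u p X = 0) (hw : covD A₀ w p X = 0)
include hF hA₀ hu hw

theorem covD_lineProj {s : M → C3} (hs : MDifferentiableAt 𝓘(ℝ, Plane) 𝓘(ℝ, C3) s p) :
    covD A₀ (fun q => lineProj (u q) (w q) (s q)) p X =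
      lineProj (u p) (w p) (covD A₀ s p X) := by
  simp only [lineProj_apply]
  rw [covD_smul (mdifferentiableAt_dotProduct hF.mdifferentiableAt_right hs)
    hF.mdifferentiableAt_left, hA₀.dmap_dotProduct hF.mdifferentiableAt_right hs, hu, hw,
    zero_dotProduct, zero_add, smul_zero, add_zero]

theorem covD_gamma (ζ : ℂ) {s : M → C3} (hs : MDifferentiableAt 𝓘(ℝ, Plane) 𝓘(ℝ, C3) s p) :
    covD A₀ (fun q => gamma (L q) (L' q) ζ (s q)) p X =
      gamma (L p) (L' p) ζ (covD A₀ s p X) := by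
  have hΓ : ∀ᶠ q in 𝓝 p, ∀ v, gamma (L q) (L' q) ζ v =
      v + (ζ - 1) • lineProj (u q) (w q) v + (ζ⁻¹ - 1) • lineProj (w q) (u q) v := by
    filter_upwards [hF.pair, hF.span_left, hF.span_right] with q hq hL hL' v
    rw [hL, hL', hq.gamma_apply, mul_smul, mul_smul]
    rfl
  have hl := hF.mdifferentiableAt_lineProj hs
  have hr := hF.symm.mdifferentiableAt_lineProj hs
  have hl' : MDifferentiableAt 𝓘(ℝ, Plane) 𝓘(ℝ, C3)
      (fun q => (ζ - 1) • lineProj (u q) (w q) (s q)) p :=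
    mdifferentiableAt_smul mdifferentiableAt_const hl
  have hr' : MDifferentiableAt 𝓘(ℝ, Plane) 𝓘(ℝ, C3)
      (fun q => (ζ⁻¹ - 1) • lineProj (w q) (u q) (s q)) p :=
    mdifferentiableAt_smul mdifferentiableAt_const hr
  rw [covD_congr (hΓ.mono fun q hq => hq (s q)), hΓ.self_of_nhds,
    covD_add (s := fun q => s q + (ζ - 1) • lineProj (u q) (w q) (s q)) (hs.add hl') hr',
    covD_add hs hl', covD_const_smul _ hl, covD_const_smul _ hr, hF.covD_lineProj hA₀ hu hw hs,
    hF.symm.covD_lineProj hA₀ hw hu hs]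

theorem gaugeAct_gamma_covD_eq_covD {ζ : ℂ} (hζ : ζ ≠ 0) {b : C3}
    (hA : A p X = A₀ p X + crossEnd b)
    (hA' : A' p X = A₀ p X + crossEnd (gamma (L p) (L' p) ζ b)) {s : M → C3}
    (hs : MDifferentiableAt 𝓘(ℝ, Plane) 𝓘(ℝ, C3) s p) :
    gaugeAct (fun q => gamma (L q) (L' q) ζ) (covD A) s p X = covD A' s p X := by
  have hp := hF.pair.self_of_nhds
  have hL := hF.span_left.self_of_nhds
  have hL' := hF.span_right.self_of_nhds
  have hinv : ∀ᶠ q in 𝓝 p, (gamma (L q) (L' q) ζ).inverse (s q) = gamma (L q) (L' q) ζ⁻¹ (s q) := by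
    filter_upwards [hF.pair, hF.span_left, hF.span_right] with q hq hL hL'
    rw [hL, hL', hq.gamma_inverse hζ]
  have hcancel (v : C3) : gamma (L p) (L' p) ζ (gamma (L p) (L' p) ζ⁻¹ v) = v := by
    rw [hL, hL', ← ContinuousLinearMap.comp_apply, hp.gamma_comp_gamma_inv hζ]
    rfl
  have hcov {B : ConnForm M} {d : C3} (hB : B p X = A₀ p X + crossEnd d) (σ : M → C3) :
      covD B σ p X = covD A₀ σ p X + crossProduct d (σ p) := by
    rw [covD, hB, covD, _root_.add_apply, crossEnd_apply, add_assoc]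
  calc gaugeAct (fun q => gamma (L q) (L' q) ζ) (covD A) s p X
      = gamma (L p) (L' p) ζ (covD A (fun q => gamma (L q) (L' q) ζ⁻¹ (s q)) p X) :=
        congrArg _ (covD_congr hinv X)
    _ = covD A₀ s p X + gamma (L p) (L' p) ζ (crossProduct b (gamma (L p) (L' p) ζ⁻¹ (s p))) := by
        rw [hcov hA, map_add, hF.covD_gamma hA₀ hu hw _ hs, hcancel]
    _ = covD A₀ s p X + crossProduct (gamma (L p) (L' p) ζ b) (s p) := by
        rw [hL, hL', hp.gamma_cross hζ, ← hL, ← hL', hcancel]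
    _ = covD A' s p X := (hcov hA' s).symm

end IsLocalHyperbolicFrame

end ParallelFrame

/-! ### Moving frames -/

section MovingFrame

variable {M : Type*} [TopologicalSpace M] [ChartedSpace Plane M]

/-- Smooth maps that form a positively oriented orthonormal frame at every point; the frame turns
with angular velocity `Ω`, a one-form with values in `ℝ³`. -/
structure IsMovingFrame (n t w : M → R3) (Ω : ∀ p : M, TangentSpace 𝓘(ℝ, Plane) p →L[ℝ] R3) :
    Prop where
  smooth_n : ContMDiff 𝓘(ℝ, Plane) 𝓘(ℝ, R3) ∞ n
  smooth_t : ContMDiff 𝓘(ℝ, Plane) 𝓘(ℝ, R3) ∞ t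
  ortho : ∀ p, IsOrthoFrame (n p) (t p) (w p)
  dmap_n : ∀ p X, dmap n p X = cross (Ω p X) (n p)
  dmap_t : ∀ p X, dmap t p X = cross (Ω p X) (t p)

theorem contMDiffAt_smul_add_smul {f g : M → R3} {p : M}
    (hf : ContMDiffAt 𝓘(ℝ, Plane) 𝓘(ℝ, R3) ∞ f p) (hg : ContMDiffAt 𝓘(ℝ, Plane) 𝓘(ℝ, R3) ∞ g p)
    (k l : ℝ) : ContMDiffAt 𝓘(ℝ, Plane) 𝓘(ℝ, R3) ∞ (fun q => k • f q + l • g q) p :=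
  (contMDiffAt_clm (k • ContinuousLinearMap.id ℝ R3) hf).add
    (contMDiffAt_clm (l • ContinuousLinearMap.id ℝ R3) hg)

theorem dmap_smul_add_smul {f g : M → R3} {p : M}
    (hf : MDifferentiableAt 𝓘(ℝ, Plane) 𝓘(ℝ, R3) f p)
    (hg : MDifferentiableAt 𝓘(ℝ, Plane) 𝓘(ℝ, R3) g p) (k l : ℝ) (X : TangentSpace 𝓘(ℝ, Plane) p) :
    dmap (fun q => k • f q + l • g q) p X = k • dmap f p X + l • dmap g p X := by
  have hk := dmap_clm (k • ContinuousLinearMap.id ℝ R3) hf X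
  have hl := dmap_clm (l • ContinuousLinearMap.id ℝ R3) hg X
  have hadd := dmap_add (mdifferentiableAt_clm (k • ContinuousLinearMap.id ℝ R3) hf)
    (mdifferentiableAt_clm (l • ContinuousLinearMap.id ℝ R3) hg)
  exact (DFunLike.congr_fun hadd X).trans (congrArg₂ (· + ·) hk hl)

theorem exists_isMovingFrame {n t : M → R3} (hn : ContMDiff 𝓘(ℝ, Plane) 𝓘(ℝ, R3) ∞ n)
    (ht : ContMDiff 𝓘(ℝ, Plane) 𝓘(ℝ, R3) ∞ t)
    (h : ∀ p, IsOrthoFrame (n p) (t p) (cross (n p) (t p))) :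
    ∃ Ω, IsMovingFrame n t (fun p => cross (n p) (t p)) Ω := by
  have hn' (p : M) := hn.mdifferentiable (by simp) p
  have ht' (p : M) := ht.mdifferentiable (by simp) p
  refine ⟨fun p => (crossR (n p)).comp (dmap n p) +
    ((innerSL ℝ (cross (n p) (t p))).comp (dmap t p)).smulRight (n p), hn, ht, h, ?_, ?_⟩
  · intro p X
    have hnn := inner_dmap_add_inner_dmap_of_inner_eq (hn' p) (hn' p) (fun q => (h q).n_n) X
    have hn_dn : inner ℝ (dmap n p X) (n p) = (0 : ℝ) := by
      rw [real_inner_comm]; linarith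
    change dmap n p X = crossR (cross (n p) (dmap n p X) +
      (inner ℝ (cross (n p) (t p)) (dmap t p X) : ℝ) • n p) (n p)
    rw [map_add, map_smul, _root_.add_apply, _root_.smul_apply, crossR_apply, crossR_apply,
      cross_cross_left, (h p).n_n, hn_dn, cross_self_R3]
    module
  · intro p X
    have htt := inner_dmap_add_inner_dmap_of_inner_eq (ht' p) (ht' p) (fun q => (h q).t_t) X
    have ht_dt : inner ℝ (t p) (dmap t p X) = (0 : ℝ) := by linarith
    have hdn_t : inner ℝ (dmap n p X) (t p) = -(inner ℝ (n p) (dmap t p X) : ℝ) := by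
      have hnt := inner_dmap_add_inner_dmap_of_inner_eq (hn' p) (ht' p) (fun q => (h q).n_t) X
      rw [real_inner_comm]; linarith
    change dmap t p X = crossR (cross (n p) (dmap n p X) +
      (inner ℝ (cross (n p) (t p)) (dmap t p X) : ℝ) • n p) (t p)
    rw [map_add, map_smul, _root_.add_apply, _root_.smul_apply, crossR_apply, crossR_apply,
      cross_cross_left, (h p).n_t, hdn_t]
    conv_lhs => rw [(h p).decomp (dmap t p X), ht_dt]
    module

namespace IsMovingFrame

variable {n t w : M → R3} {Ω : ∀ p : M, TangentSpace 𝓘(ℝ, Plane) p →L[ℝ] R3}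
  (h : IsMovingFrame n t w Ω)
include h

theorem mdifferentiableAt_n (p : M) : MDifferentiableAt 𝓘(ℝ, Plane) 𝓘(ℝ, R3) n p :=
  h.smooth_n.mdifferentiable (by simp) p

theorem mdifferentiableAt_t (p : M) : MDifferentiableAt 𝓘(ℝ, Plane) 𝓘(ℝ, R3) t p :=
  h.smooth_t.mdifferentiable (by simp) p

theorem eq_cross : w = fun p => crossR (n p) (t p) :=
  funext fun p => (h.ortho p).cross_n_t.symm

theorem smooth_w : ContMDiff 𝓘(ℝ, Plane) 𝓘(ℝ, R3) ∞ w := fun p => by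
  rw [h.eq_cross]
  exact contMDiffAt_bilin crossR (h.smooth_n p) (h.smooth_t p)

theorem mdifferentiableAt_w (p : M) : MDifferentiableAt 𝓘(ℝ, Plane) 𝓘(ℝ, R3) w p :=
  h.smooth_w.mdifferentiable (by simp) p

theorem dmap_w (p : M) (X : TangentSpace 𝓘(ℝ, Plane) p) : dmap w p X = cross (Ω p X) (w p) := by
  rw [h.eq_cross, dmap_bilin crossR (h.mdifferentiableAt_n p) (h.mdifferentiableAt_t p), h.dmap_n,
    h.dmap_t]
  simp only [crossR_apply]
  rw [cross_leibniz (Ω p X), add_comm]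

theorem cross_dmap_n (p : M) (X : TangentSpace 𝓘(ℝ, Plane) p) :
    cross (n p) (dmap n p X) = Ω p X - (inner ℝ (n p) (Ω p X) : ℝ) • n p := by
  rw [h.dmap_n, cross_cross_right, (h.ortho p).n_n, one_smul]

theorem rotate {C S : ℝ} (hCS : C ^ 2 + S ^ 2 = 1) :
    IsMovingFrame (fun p => C • n p - S • t p) (fun p => C • t p + S • n p) w Ω where
  smooth_n p := by
    simp only [sub_eq_add_neg, ← neg_smul]
    exact contMDiffAt_smul_add_smul (h.smooth_n p) (h.smooth_t p) C (-S)
  smooth_t p := contMDiffAt_smul_add_smul (h.smooth_t p) (h.smooth_n p) C S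
  ortho p := (h.ortho p).rotate hCS
  dmap_n p X := by
    simp only [sub_eq_add_neg, ← neg_smul]
    rw [dmap_smul_add_smul (h.mdifferentiableAt_n p) (h.mdifferentiableAt_t p), h.dmap_n, h.dmap_t]
    simp only [← crossR_apply, map_add, map_smul]
  dmap_t p X := by
    rw [dmap_smul_add_smul (h.mdifferentiableAt_t p) (h.mdifferentiableAt_n p), h.dmap_n, h.dmap_t]
    simp only [← crossR_apply, map_add, map_smul]

end IsMovingFrame

end MovingFrame

/-! ### Null lines of a moving frame -/

theorem conjLine_span_add_I_smul (n t : R3) :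
    conjLine (Submodule.span ℂ {cx n + Complex.I • cx t}) =
      Submodule.span ℂ {(1 / 2 : ℂ) • (cx n - Complex.I • cx t)} := by
  have hstar : star (cx n + Complex.I • cx t) = cx n - Complex.I • cx t := by
    rw [star_add, star_smul, star_cx, star_cx, Complex.star_def, Complex.conj_I, neg_smul,
      sub_eq_add_neg]
  rw [conjLine_span, hstar, Submodule.span_singleton_smul_eq (by norm_num)]

theorem dotProduct_eq_zero_of_cross_mem_span {u v : C3} (hu : u ⬝ᵥ u = 0) (hu₀ : u ≠ 0)
    (h : crossProduct v u ∈ Submodule.span ℂ {u}) : u ⬝ᵥ v = 0 := by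
  obtain ⟨k, hk⟩ := Submodule.mem_span_singleton.1 h
  have hcross : crossProduct u (crossProduct v u) = -((u ⬝ᵥ v) • u) := by
    rw [cross_cross_eq_smul_sub_smul', hu, zero_smul, zero_sub, dotProduct_comm]
  rw [← hk, map_smul, cross_self, smul_zero, zero_eq_neg] at hcross
  exact (smul_eq_zero.1 hcross).resolve_right hu₀

theorem IsOrthoFrame.cross_null {n t w : R3} (h : IsOrthoFrame n t w) :
    crossProduct (cx n + Complex.I • cx t) ((1 / 2 : ℂ) • (cx n - Complex.I • cx t)) =
      -(Complex.I • cx w) := by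
  have hnt : crossProduct (cx n) (cx t) = cx w := by rw [cx_crossProduct, h.cross_n_t]
  have htn : crossProduct (cx t) (cx n) = -cx w := by rw [← cross_anticomm, hnt]
  simp only [map_smul, map_add, map_sub, LinearMap.add_apply, LinearMap.smul_apply, cross_self,
    hnt, htn]
  module

section MovingFrame

variable {M : Type*} [TopologicalSpace M] [ChartedSpace Plane M]

/-- The metric connection that annihilates the vectors of a frame with angular velocity `Ω`. -/
noncomputable def velocityForm (Ω : ∀ p : M, TangentSpace 𝓘(ℝ, Plane) p →L[ℝ] R3) : ConnForm M :=
  fun p => -crossEndR.comp (Ω p)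

variable {Ω : ∀ p : M, TangentSpace 𝓘(ℝ, Plane) p →L[ℝ] R3}

theorem isMetricConn_velocityForm : IsMetricConn (velocityForm Ω) := by
  intro p X u v
  change -crossProduct (cx (Ω p X)) u ⬝ᵥ v + u ⬝ᵥ -crossProduct (cx (Ω p X)) v = 0
  rw [neg_dotProduct, dotProduct_neg, dotProduct_comm _ v, triple_product_permutation u,
    triple_product_permutation v, ← cross_anticomm u v, dotProduct_neg]
  ring

theorem covD_velocityForm_cx {e : M → R3} {p : M}
    (he : MDifferentiableAt 𝓘(ℝ, Plane) 𝓘(ℝ, R3) e p) {X : TangentSpace 𝓘(ℝ, Plane) p}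
    (hd : dmap e p X = cross (Ω p X) (e p)) :
    covD (velocityForm Ω) (fun q => cx (e q)) p X = 0 := by
  change dmap (fun q => cxL (e q)) p X + -crossProduct (cx (Ω p X)) (cx (e p)) = 0
  rw [dmap_clm cxL he, hd, cx_crossProduct]
  exact add_neg_cancel _

/-- The vector `s` for which `s × ·` is the difference of the connection with spectral parameter
`z` associated with `n` and of `velocityForm Ω`. -/
noncomputable def spectralVelocity (c : LorentzConformalStructure M) (n : M → R3)
    (Ω : ∀ p : M, TangentSpace 𝓘(ℝ, Plane) p →L[ℝ] R3) (z : ℂ) (p : M)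
    (X : TangentSpace 𝓘(ℝ, Plane) p) : C3 :=
  cx (Ω p X) + (((z + z⁻¹) / 2 - 1) • cx (cross (n p) (dmap n p X)) +
    ((z - z⁻¹) / 2) • cx (cross (n p) (dmap n p (c.hodge p X))))

theorem assocForm_eq_velocityForm_add (c : LorentzConformalStructure M) (n : M → R3) (z : ℂ)
    (p : M) (X : TangentSpace 𝓘(ℝ, Plane) p) : assocForm c n z p X =
      velocityForm Ω p X + crossEnd (spectralVelocity c n Ω z p X) := by
  rw [assocForm_apply, spectralVelocity, crossEnd_add (cx _)]
  exact (neg_add_cancel_left _ _).symm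

theorem cx_dotProduct_spectralVelocity_self (c : LorentzConformalStructure M) (n : M → R3) (z : ℂ)
    (p : M) (X : TangentSpace 𝓘(ℝ, Plane) p) :
    cx (n p) ⬝ᵥ spectralVelocity c n Ω z p X = (inner ℝ (n p) (Ω p X) : ℝ) := by
  simp only [spectralVelocity, dotProduct_add, dotProduct_smul, cx_dotProduct, inner_cross_left]
  simp

namespace IsMovingFrame

variable {n t w : M → R3} (h : IsMovingFrame n t w Ω) (c : LorentzConformalStructure M) (z : ℂ)
  (p : M) (X : TangentSpace 𝓘(ℝ, Plane) p)
include h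

theorem cx_dotProduct_spectralVelocity {e : R3} (he : inner ℝ e (n p) = (0 : ℝ)) :
    cx e ⬝ᵥ spectralVelocity c n Ω z p X = (z + z⁻¹) / 2 * (inner ℝ e (Ω p X) : ℝ) +
      (z - z⁻¹) / 2 * (inner ℝ e (Ω p (c.hodge p X)) : ℝ) := by
  simp only [spectralVelocity, dotProduct_add, dotProduct_smul, cx_dotProduct, h.cross_dmap_n,
    inner_sub_right, real_inner_smul_right, he, mul_zero, sub_zero, smul_eq_mul]
  ring

theorem null_dotProduct_spectralVelocity (k : ℂ) :
    (cx (n p) + k • cx (t p)) ⬝ᵥ spectralVelocity c n Ω z p X = (inner ℝ (n p) (Ω p X) : ℝ) +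
      k * ((z + z⁻¹) / 2 * (inner ℝ (t p) (Ω p X) : ℝ) +
        (z - z⁻¹) / 2 * (inner ℝ (t p) (Ω p (c.hodge p X)) : ℝ)) := by
  have ht : inner ℝ (t p) (n p) = (0 : ℝ) := by rw [real_inner_comm, (h.ortho p).n_t]
  rw [add_dotProduct, smul_dotProduct, cx_dotProduct_spectralVelocity_self,
    h.cx_dotProduct_spectralVelocity c z p X ht, smul_eq_mul]

theorem contMDiffAt_null (k : ℂ) :
    ContMDiffAt 𝓘(ℝ, Plane) 𝓘(ℝ, C3) ∞ (fun q => cx (n q) + k • cx (t q)) p :=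
  (contMDiffAt_cx (h.smooth_n p)).add
    (contMDiffAt_bilin smulB contMDiffAt_const (contMDiffAt_cx (h.smooth_t p)))

theorem covD_velocityForm_null (k : ℂ) (X : TangentSpace 𝓘(ℝ, Plane) p) :
    covD (velocityForm Ω) (fun q => cx (n q) + k • cx (t q)) p X = 0 := by
  have hcx {e : M → R3} (he : ContMDiff 𝓘(ℝ, Plane) 𝓘(ℝ, R3) ∞ e) :
      MDifferentiableAt 𝓘(ℝ, Plane) 𝓘(ℝ, C3) (fun q => cx (e q)) p :=
    (contMDiffAt_cx (he p)).mdifferentiableAt (by simp)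
  rw [covD_add (hcx h.smooth_n) (mdifferentiableAt_smul mdifferentiableAt_const (hcx h.smooth_t)),
    covD_const_smul k (hcx h.smooth_t), covD_velocityForm_cx (h.mdifferentiableAt_n p)
    (h.dmap_n p X), covD_velocityForm_cx (h.mdifferentiableAt_t p) (h.dmap_t p X), smul_zero,
    add_zero]

theorem isLocalHyperbolicFrame {L : M → Submodule ℂ C3}
    (hL : ∀ p, L p = Submodule.span ℂ {cx (n p) + Complex.I • cx (t p)}) :
    IsLocalHyperbolicFrame L (fun q => conjLine (L q)) (fun q => cx (n q) + Complex.I • cx (t q))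
      (fun q => (1 / 2 : ℂ) • (cx (n q) - Complex.I • cx (t q))) p where
  smooth_left := h.contMDiffAt_null p Complex.I
  smooth_right := by
    simp only [sub_eq_add_neg, ← neg_smul]
    exact contMDiffAt_bilin smulB contMDiffAt_const (h.contMDiffAt_null p (-Complex.I))
  pair := Filter.Eventually.of_forall fun q => (h.ortho q).isHyperbolicPair
  span_left := Filter.Eventually.of_forall hL
  span_right := Filter.Eventually.of_forall fun q => by rw [hL q, conjLine_span_add_I_smul]

theorem null_dotProduct_eq_zero_of_isParallel {L : M → Submodule ℂ C3}
    (hL : ∀ p, L p = Submodule.span ℂ {cx (n p) + Complex.I • cx (t p)})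
    (hpar : IsParallel (covD (assocForm c n z)) L) :
    (cx (n p) + Complex.I • cx (t p)) ⬝ᵥ spectralVelocity c n Ω z p X = 0 := by
  have hmem := hpar _ p (h.contMDiffAt_null p Complex.I) (Filter.Eventually.of_forall fun q =>
    hL q ▸ Submodule.mem_span_singleton_self _) X
  have hcov : covD (assocForm c n z) (fun q => cx (n q) + Complex.I • cx (t q)) p X =
      crossProduct (spectralVelocity c n Ω z p X) (cx (n p) + Complex.I • cx (t p)) := by
    rw [← zero_add (crossProduct _ _), ← h.covD_velocityForm_null p Complex.I X, covD, covD,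
      assocForm_eq_velocityForm_add (Ω := Ω), _root_.add_apply, add_assoc]
    rfl
  rw [hcov, hL p] at hmem
  have hpair := (h.ortho p).isHyperbolicPair
  refine dotProduct_eq_zero_of_cross_mem_span hpair.left_null (fun h₀ => ?_) hmem
  simpa [h₀] using hpair.dot_eq_one

end IsMovingFrame

end MovingFrame

/-! ### The Bäcklund angle and the dressing parameter -/

/-- The cosine of the angle between the normals of a surface and of its Bäcklund transform. -/
noncomputable def cosBacklund (a : ℝ) : ℝ := (1 - a ^ 2) / (1 + a ^ 2)

/-- The sine of the angle between the normals of a surface and of its Bäcklund transform. -/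
noncomputable def sinBacklund (a : ℝ) : ℝ := 2 * a / (1 + a ^ 2)

theorem cosBacklund_sq_add_sinBacklund_sq (a : ℝ) : cosBacklund a ^ 2 + sinBacklund a ^ 2 = 1 := by
  have : 1 + a ^ 2 ≠ 0 := by positivity
  unfold cosBacklund sinBacklund
  field_simp
  ring

theorem cosBacklund_eq {a : ℝ} (ha : 0 < a) : cosBacklund a = (a⁻¹ - a) / (a⁻¹ + a) := by
  unfold cosBacklund
  field_simp

theorem sinBacklund_eq {a : ℝ} (ha : 0 < a) : sinBacklund a = 2 / (a + a⁻¹) := by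
  unfold sinBacklund
  field_simp
  ring

theorem one_add_I_mul_ne_zero (a : ℝ) : 1 + Complex.I * a ≠ 0 := fun h => by
  simpa using congrArg Complex.re h

theorem one_sub_I_mul_ne_zero (a : ℝ) : 1 - Complex.I * a ≠ 0 := fun h => by
  simpa using congrArg Complex.re h

theorem cayley_eq (a : ℝ) :
    (1 + Complex.I * a) / (1 - Complex.I * a) = cosBacklund a + Complex.I * sinBacklund a := by
  have h : (1 : ℂ) + a ^ 2 ≠ 0 := by exact_mod_cast (by positivity : 1 + a ^ 2 ≠ 0)
  rw [div_eq_iff (one_sub_I_mul_ne_zero a), cosBacklund, sinBacklund]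
  push_cast
  field_simp
  linear_combination (2 * (a : ℂ) ^ 2) * Complex.I_sq

theorem cayley_inv_eq (a : ℝ) :
    ((1 + Complex.I * a) / (1 - Complex.I * a))⁻¹ = cosBacklund a - Complex.I * sinBacklund a := by
  have h : (cosBacklund a : ℂ) ^ 2 + (sinBacklund a : ℂ) ^ 2 = 1 := by
    exact_mod_cast cosBacklund_sq_add_sinBacklund_sq a
  rw [cayley_eq]
  refine inv_eq_of_mul_eq_one_right ?_
  linear_combination h - (sinBacklund a : ℂ) ^ 2 * Complex.I_sq

/-- The argument of `Γ` in the dressing transformation `r`. -/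
noncomputable def dressParam (a : ℝ) (z : ℂ) : ℂ :=
  (1 + Complex.I * a) / (1 - Complex.I * a) * ((z - Complex.I * a) / (z + Complex.I * a))

theorem dressParam_ne_zero {a : ℝ} {z : ℂ} (hz : z ≠ Complex.I * a)
    (hz' : z ≠ -(Complex.I * a)) : dressParam a z ≠ 0 :=
  mul_ne_zero (div_ne_zero (one_add_I_mul_ne_zero a) (one_sub_I_mul_ne_zero a))
    (div_ne_zero (sub_ne_zero.2 hz) fun h => hz' (eq_neg_of_add_eq_zero_left h))

theorem dressParam_mul_eq {a : ℝ} {z x y : ℂ} (hz : z ≠ -(Complex.I * a))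
    (h : (z - Complex.I * a) * ((cosBacklund a + Complex.I * sinBacklund a) * x) =
      (z + Complex.I * a) * y) :
    dressParam a z * x = y := by
  have hz' : z + Complex.I * a ≠ 0 := fun h => hz (eq_neg_of_add_eq_zero_left h)
  rw [dressParam, cayley_eq]
  field_simp
  linear_combination h

theorem dressParam_inv_mul_eq {a : ℝ} {z x y : ℂ} (hz : z ≠ Complex.I * a)
    (h : (z + Complex.I * a) * ((cosBacklund a - Complex.I * sinBacklund a) * x) =
      (z - Complex.I * a) * y) :
    (dressParam a z)⁻¹ * x = y := by
  have hz' : z - Complex.I * a ≠ 0 := sub_ne_zero.2 hz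
  rw [dressParam, mul_inv, cayley_inv_eq, inv_div]
  field_simp
  linear_combination h

theorem dressParam_one (a : ℝ) : dressParam a 1 = 1 := by
  have h1 := one_add_I_mul_ne_zero a
  have h2 := one_sub_I_mul_ne_zero a
  rw [dressParam]
  field_simp

theorem hasDerivAt_dressParam (a : ℝ) :
    HasDerivAt (dressParam a) (Complex.I * sinBacklund a) 1 := by
  have h1 := one_add_I_mul_ne_zero a
  have h2 := one_sub_I_mul_ne_zero a
  have h3 : (1 : ℂ) + a ^ 2 ≠ 0 := by exact_mod_cast (by positivity : 1 + a ^ 2 ≠ 0)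
  have h := (((hasDerivAt_id (1 : ℂ)).sub_const (Complex.I * a)).div
    ((hasDerivAt_id (1 : ℂ)).add_const (Complex.I * a)) h1).const_mul
      ((1 + Complex.I * a) / (1 - Complex.I * a))
  refine h.congr_deriv ?_
  simp only [sinBacklund, id]
  push_cast
  field_simp
  linear_combination (2 * Complex.I * (a : ℂ) ^ 3) * Complex.I_sq

/-! ### The Bäcklund transformation of harmonic maps -/

/-- The normal of the Bäcklund transform of a surface with normal `n`: the rotation of `n` by the
Bäcklund angle in the plane it spans with `t`. -/
noncomputable def backlundNormal {M : Type*} (a : ℝ) (n t : M → R3) : M → R3 :=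
  fun p => cosBacklund a • n p - sinBacklund a • t p

theorem cx_backlund_null {i : ℂ} (hi : i ^ 2 = -1) (n t : R3) (a : ℝ) :
    cx (cosBacklund a • n - sinBacklund a • t) + i • cx (cosBacklund a • t + sinBacklund a • n) =
      (cosBacklund a + i * sinBacklund a : ℂ) • (cx n + i • cx t) := by
  rw [cx_add, cx_sub, cx_smul, cx_smul, cx_smul, cx_smul]
  linear_combination (norm := module) -((sinBacklund a : ℂ) * hi) • cx t

theorem backlund_spectral_identity {i z a β τ β' τ' : ℂ} (hi : i ^ 2 = -1) (hz : z ≠ 0)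
    (ha : a ≠ 0) (hβ : 2 * β = (a - a⁻¹) * τ + (a + a⁻¹) * τ')
    (hβ' : 2 * β' = (a - a⁻¹) * τ' + (a + a⁻¹) * τ) :
    (z - i * a) * (-β' + i * ((z + z⁻¹) / 2 * τ' + (z - z⁻¹) / 2 * τ)) =
      (z + i * a) * (β + i * ((z + z⁻¹) / 2 * τ + (z - z⁻¹) / 2 * τ')) := by
  have hz' : z * z⁻¹ = 1 := mul_inv_cancel₀ hz
  have ha' : a * a⁻¹ = 1 := mul_inv_cancel₀ ha
  linear_combination i * ((τ' - τ) * hz' + (τ' - τ) * i ^ 2 * ha' + (τ' - τ) * hi) -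
    ((z - i * a) * β' + (z + i * a) * β) * hi +
    i ^ 2 / 2 * ((z - i * a) * hβ' + (z + i * a) * hβ)

section Backlund

variable {M : Type*} [TopologicalSpace M] [ChartedSpace Plane M]

theorem analyticAt_assocForm (c : LorentzConformalStructure M) (N : M → R3) (p : M)
    (X : TangentSpace 𝓘(ℝ, Plane) p) {α : ℂ} (hα : α ≠ 0) :
    AnalyticAt ℂ (fun z => assocForm c N z p X) α :=
  (analyticAt_const.add (analyticAt_id.fun_smul analyticAt_const)).add
    ((analyticAt_inv hα).fun_smul analyticAt_const)

/-- A moving frame for which the null line spanned by `n + i t` is parallel for the connection with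
spectral parameter `ia` associated with `n`. -/
structure IsBacklundFrame (c : LorentzConformalStructure M) (a : ℝ) (n t w : M → R3)
    (Ω : ∀ p : M, TangentSpace 𝓘(ℝ, Plane) p →L[ℝ] R3) : Prop extends IsMovingFrame n t w Ω where
  velocity_n : ∀ p X, 2 * inner ℝ (n p) (Ω p X) =
    ((a - a⁻¹) * inner ℝ (t p) (Ω p X) + (a + a⁻¹) * inner ℝ (t p) (Ω p (c.hodge p X)) : ℝ)

variable {c : LorentzConformalStructure M} {a : ℝ} {n t w f : M → R3}
  {Ω : ∀ p : M, TangentSpace 𝓘(ℝ, Plane) p →L[ℝ] R3} {L : M → Submodule ℂ C3}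

theorem IsMovingFrame.isBacklundFrame (h : IsMovingFrame n t w Ω)
    (hL : ∀ p, L p = Submodule.span ℂ {cx (n p) + Complex.I • cx (t p)})
    (hpar : IsParallel (covD (assocForm c n (Complex.I * a))) L) :
    IsBacklundFrame c a n t w Ω where
  toIsMovingFrame := h
  velocity_n p X := by
    have hzero := h.null_dotProduct_eq_zero_of_isParallel c _ p X hL hpar
    rw [h.null_dotProduct_spectralVelocity, mul_inv, Complex.inv_I] at hzero
    apply Complex.ofReal_injective
    push_cast
    linear_combination 2 * hzero - ((a - (a : ℂ)⁻¹) * (inner ℝ (t p) (Ω p X) : ℝ) +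
      (a + (a : ℂ)⁻¹) * (inner ℝ (t p) (Ω p (c.hodge p X)) : ℝ)) * Complex.I_sq

namespace IsMovingFrame

variable (h : IsMovingFrame n t w Ω) (p : M)
include h

theorem hasDerivAt_dressing (hL : ∀ p, L p = Submodule.span ℂ {cx (n p) + Complex.I • cx (t p)})
    (a : ℝ) : HasDerivAt (fun z => dressing L a z p) (crossEnd (cx (-sinBacklund a • w p))) 1 := by
  have hI : Complex.I * sinBacklund a * Complex.I = -sinBacklund a := by
    linear_combination (sinBacklund a : ℂ) * Complex.I_sq
  have hγ := (h.ortho p).isHyperbolicPair.hasDerivAt_gamma (hasDerivAt_dressParam a)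
    (dressParam_one a)
  rw [← cross_anticomm, (h.ortho p).cross_null, neg_neg, smul_smul, hI, ← Complex.ofReal_neg,
    ← cx_smul] at hγ
  simp only [dressing, hL, conjLine_span_add_I_smul]
  exact hγ

theorem cx_dotProduct_eq_zero (hL : ∀ p, L p = Submodule.span ℂ {cx (n p) + Complex.I • cx (t p)})
    {u : C3} (hu : u ∈ L p ⊔ conjLine (L p)) : cx (w p) ⬝ᵥ u = 0 := by
  have hwn : cx (w p) ⬝ᵥ cx (n p) = 0 := by
    rw [cx_dotProduct, real_inner_comm, (h.ortho p).n_w, Complex.ofReal_zero]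
  have hwt : cx (w p) ⬝ᵥ cx (t p) = 0 := by
    rw [cx_dotProduct, real_inner_comm, (h.ortho p).t_w, Complex.ofReal_zero]
  rw [hL, conjLine_span_add_I_smul] at hu
  obtain ⟨_, hx, _, hy, rfl⟩ := Submodule.mem_sup.1 hu
  obtain ⟨k, rfl⟩ := Submodule.mem_span_singleton.1 hx
  obtain ⟨l, rfl⟩ := Submodule.mem_span_singleton.1 hy
  simp only [dotProduct_add, dotProduct_sub, dotProduct_smul, hwn, hwt, smul_zero, add_zero,
    sub_zero]

end IsMovingFrame

namespace IsBacklundFrame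

variable (h : IsBacklundFrame c a n t w Ω)
include h

theorem isMovingFrame_backlundNormal :
    IsMovingFrame (backlundNormal a n t) (fun p => cosBacklund a • t p + sinBacklund a • n p) w Ω :=
  h.rotate (cosBacklund_sq_add_sinBacklund_sq a)

theorem velocity_n_hodge (p : M) (X : TangentSpace 𝓘(ℝ, Plane) p) :
    2 * inner ℝ (n p) (Ω p (c.hodge p X)) = ((a - a⁻¹) * inner ℝ (t p) (Ω p (c.hodge p X)) +
      (a + a⁻¹) * inner ℝ (t p) (Ω p X) : ℝ) := by
  rw [h.velocity_n, c.hodge_hodge]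

theorem inner_backlundNormal (p : M) : inner ℝ (backlundNormal a n t p) (n p) = cosBacklund a := by
  rw [backlundNormal, inner_sub_left, real_inner_smul_left, real_inner_smul_left,
    (h.ortho p).n_n, real_inner_comm, (h.ortho p).n_t]
  ring

theorem dressingInfty_apply
    (hL : ∀ p, L p = Submodule.span ℂ {cx (n p) + Complex.I • cx (t p)}) (p : M) :
    dressingInfty L a p (cx (n p)) = cx (backlundNormal a n t p) := by
  have ho := h.ortho p
  have htn : inner ℝ (t p) (n p) = (0 : ℝ) := by rw [real_inner_comm, ho.n_t]
  rw [dressingInfty, hL, conjLine_span_add_I_smul, ho.isHyperbolicPair.gamma_apply, cayley_inv_eq,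
    cayley_eq, backlundNormal, cx_sub, cx_smul, cx_smul]
  simp only [add_dotProduct, sub_dotProduct, smul_dotProduct, cx_dotProduct, ho.n_n, htn]
  push_cast
  linear_combination (norm := module) ((sinBacklund a : ℂ) * Complex.I_sq) • cx (t p)

variable (ha : a ≠ 0)
include ha

theorem inner_backlundNormal_velocity (p : M) (X : TangentSpace 𝓘(ℝ, Plane) p) :
    inner ℝ (backlundNormal a n t p) (Ω p X) = (-inner ℝ (n p) (Ω p (c.hodge p X)) : ℝ) := by
  have hn := (eq_div_iff two_ne_zero).2 ((mul_comm _ _).trans (h.velocity_n p X))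
  have hn' := (eq_div_iff two_ne_zero).2 ((mul_comm _ _).trans (h.velocity_n_hodge p X))
  rw [backlundNormal, inner_sub_left, real_inner_smul_left, real_inner_smul_left, cosBacklund,
    sinBacklund, hn, hn']
  field_simp
  ring

theorem inner_rotate_velocity (p : M) (X : TangentSpace 𝓘(ℝ, Plane) p) :
    inner ℝ (cosBacklund a • t p + sinBacklund a • n p) (Ω p X) =
      (inner ℝ (t p) (Ω p (c.hodge p X)) : ℝ) := by
  have hn := (eq_div_iff two_ne_zero).2 ((mul_comm _ _).trans (h.velocity_n p X))
  rw [inner_add_left, real_inner_smul_left, real_inner_smul_left, cosBacklund, sinBacklund, hn]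
  field_simp
  ring

theorem null_dotProduct_spectralVelocity_backlundNormal (p : M) (X : TangentSpace 𝓘(ℝ, Plane) p)
    {i z : ℂ} (hi : i ^ 2 = -1) (hz : z ≠ 0) :
    (z - i * a) * ((cosBacklund a + i * sinBacklund a) *
      ((cx (n p) + i • cx (t p)) ⬝ᵥ spectralVelocity c (backlundNormal a n t) Ω z p X)) =
        (z + i * a) * ((cx (n p) + i • cx (t p)) ⬝ᵥ spectralVelocity c n Ω z p X) := by
  have hnull := h.isMovingFrame_backlundNormal.null_dotProduct_spectralVelocity c z p X i
  have hβ := congrArg Complex.ofReal (h.velocity_n p X)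
  have hβ' := congrArg Complex.ofReal (h.velocity_n_hodge p X)
  push_cast at hβ hβ'
  rw [h.inner_backlundNormal_velocity ha, h.inner_rotate_velocity ha, h.inner_rotate_velocity ha,
    c.hodge_hodge, backlundNormal, cx_backlund_null hi, smul_dotProduct, smul_eq_mul] at hnull
  rw [h.null_dotProduct_spectralVelocity, hnull, Complex.ofReal_neg]
  exact backlund_spectral_identity hi hz (Complex.ofReal_ne_zero.2 ha) hβ hβ'

theorem dressing_spectralVelocity {z : ℂ} (hz : z ≠ 0) (hz₁ : z ≠ Complex.I * a)
    (hz₂ : z ≠ -(Complex.I * a))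
    (hL : ∀ p, L p = Submodule.span ℂ {cx (n p) + Complex.I • cx (t p)}) (p : M)
    (X : TangentSpace 𝓘(ℝ, Plane) p) : dressing L a z p (spectralVelocity c n Ω z p X) =
      spectralVelocity c (backlundNormal a n t) Ω z p X := by
  have hI : (-Complex.I) ^ 2 = -1 := by rw [neg_sq, Complex.I_sq]
  have hψ : dressParam a z ≠ 0 := dressParam_ne_zero hz₁ hz₂
  have ho := h.ortho p
  have ho' := h.isMovingFrame_backlundNormal.ortho p
  rw [dressing, hL, conjLine_span_add_I_smul, ← dressParam]
  refine ho.isHyperbolicPair.gamma_eq_of_dotProduct ?_ ?_ ?_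
  · exact (eq_inv_mul_iff_mul_eq₀ hψ).2 (dressParam_mul_eq hz₂
      (h.null_dotProduct_spectralVelocity_backlundNormal ha p X Complex.I_sq hz))
  · have hv := h.null_dotProduct_spectralVelocity_backlundNormal ha p X hI hz
    simp only [neg_mul, neg_smul, sub_neg_eq_add, ← sub_eq_add_neg] at hv
    rw [smul_dotProduct, smul_dotProduct, smul_eq_mul, smul_eq_mul, mul_left_comm,
      (inv_mul_eq_iff_eq_mul₀ hψ).1 (dressParam_inv_mul_eq hz₁ hv)]
  · rw [ho.cross_null, neg_dotProduct, neg_dotProduct, smul_dotProduct, smul_dotProduct,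
      h.cx_dotProduct_spectralVelocity c z p X (by rw [real_inner_comm, ho.n_w]),
      h.isMovingFrame_backlundNormal.cx_dotProduct_spectralVelocity c z p X
        (by rw [real_inner_comm, ho'.n_w])]

theorem gaugeAct_dressing_covD {z : ℂ} (hz : z ≠ 0) (hz₁ : z ≠ Complex.I * a)
    (hz₂ : z ≠ -(Complex.I * a))
    (hL : ∀ p, L p = Submodule.span ℂ {cx (n p) + Complex.I • cx (t p)}) {s : M → C3} {p : M}
    (hs : ContMDiffAt 𝓘(ℝ, Plane) 𝓘(ℝ, C3) ∞ s p) (X : TangentSpace 𝓘(ℝ, Plane) p) :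
    gaugeAct (dressing L a z) (covD (assocForm c n z)) s p X =
      covD (assocForm c (backlundNormal a n t) z) s p X := by
  have hv : covD (velocityForm Ω) (fun q => (1 / 2 : ℂ) • (cx (n q) - Complex.I • cx (t q))) p X =
      0 := by
    simp only [sub_eq_add_neg (cx _), ← neg_smul]
    rw [covD_const_smul _ ((h.contMDiffAt_null p (-Complex.I)).mdifferentiableAt (by simp)),
      h.covD_velocityForm_null, smul_zero]
  refine (h.isLocalHyperbolicFrame p hL).gaugeAct_gamma_covD_eq_covD isMetricConn_velocityForm
    (h.covD_velocityForm_null p Complex.I X) hv (dressParam_ne_zero hz₁ hz₂)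
    (assocForm_eq_velocityForm_add c n z p X) ?_ (hs.mdifferentiableAt (by simp))
  rw [assocForm_eq_velocityForm_add (Ω := Ω), ← h.dressing_spectralVelocity ha hz hz₁ hz₂ hL]
  rfl

theorem holomorphicAcross_gaugeAct_dressing
    (hL : ∀ p, L p = Submodule.span ℂ {cx (n p) + Complex.I • cx (t p)}) {α : ℂ} (hα : α ≠ 0) :
    HolomorphicAcross (fun z => gaugeAct (dressing L a z) (covD (assocForm c n z))) α := by
  refine holomorphicAcross_of_eventuallyEq_covD
    (fun p X => analyticAt_assocForm c (backlundNormal a n t) p X hα) ?_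
  have hne (β : ℂ) : ∀ᶠ z in 𝓝[≠] α, z ≠ β :=
    nhdsNE_le_cofinite α (Set.finite_singleton β).compl_mem_cofinite
  filter_upwards [hne 0, hne (Complex.I * a), hne (-(Complex.I * a))] with z hz hz₁ hz₂ s p hs X
  exact h.gaugeAct_dressing_covD ha hz hz₁ hz₂ hL hs X

theorem cross_dmap_backlundNormal_hodge (p : M) (X : TangentSpace 𝓘(ℝ, Plane) p) :
    cross (backlundNormal a n t p) (dmap (backlundNormal a n t) p (c.hodge p X)) =
      cross (n p) (dmap n p (c.hodge p X)) + sinBacklund a • dmap w p X := by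
  have hn' : cross (backlundNormal a n t p) (dmap (backlundNormal a n t) p (c.hodge p X)) =
      Ω p (c.hodge p X) + (inner ℝ (n p) (Ω p X) : ℝ) • backlundNormal a n t p := by
    have hn := h.isMovingFrame_backlundNormal.cross_dmap_n p (c.hodge p X)
    have hΩ := h.inner_backlundNormal_velocity ha p (c.hodge p X)
    rw [c.hodge_hodge] at hΩ
    rwa [hΩ, neg_smul, sub_neg_eq_add] at hn
  have hw : dmap w p X = (inner ℝ (t p) (Ω p X) : ℝ) • n p - (inner ℝ (n p) (Ω p X) : ℝ) • t p := by
    rw [h.dmap_w, ← (h.ortho p).cross_n_t, cross_cross_right, real_inner_comm,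
      real_inner_comm (n p)]
  have hΩ := h.inner_backlundNormal_velocity ha p X
  rw [backlundNormal, inner_sub_left, real_inner_smul_left, real_inner_smul_left] at hΩ
  rw [hn', h.cross_dmap_n, hw, backlundNormal]
  linear_combination (norm := module) hΩ • n p

theorem isPotentialAt_add_smul {p : M}
    (hfp : MDifferentiableAt 𝓘(ℝ, Plane) 𝓘(ℝ, R3) f p) (hf : IsPotentialAt c n f p) :
    IsPotentialAt c (backlundNormal a n t) (fun q => f q + sinBacklund a • w q) p := fun X => by
  have hadd := dmap_smul_add_smul hfp (h.mdifferentiableAt_w p) 1 (sinBacklund a) X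
  simp only [one_smul] at hadd
  rw [hadd, hf]
  exact (h.cross_dmap_backlundNormal_hodge ha p X).symm

theorem isHarmonic_backlundNormal [IsManifold 𝓘(ℝ, Plane) ∞ M]
    (hn : IsHarmonic c n) : IsHarmonic c (backlundNormal a n t) where
  smooth := h.isMovingFrame_backlundNormal.smooth_n
  unit p := norm_eq_one_of_inner_self (h.isMovingFrame_backlundNormal.ortho p).n_n
  tension p X Y := by
    have hform : bilinForm crossR (backlundNormal a n t)
        (hodgeStar c (dmap (backlundNormal a n t))) =
          fun q => bilinForm crossR n (hodgeStar c (dmap n)) q +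
            (sinBacklund a • ContinuousLinearMap.id ℝ R3).comp (dmap w q) := by
      funext q
      ext1 Z
      exact h.cross_dmap_backlundNormal_hodge ha q Z
    have hcross := formDiffAt_bilinForm crossR (h.mdifferentiableAt_n p)
      (formDiffAt_hodgeStar c (formDiffAt_dmap h.smooth_n p))
    have hdw := formDiffAt_dmap h.smooth_w p
    rw [← extD_cross_hodgeStar c h.isMovingFrame_backlundNormal.smooth_n, hform,
      extD_add hcross (hdw.clm _), extD_clm hdw, extD_dmap h.smooth_w, map_zero, add_zero,
      extD_cross_hodgeStar c h.smooth_n, hn.tension]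

omit ha in
theorem isBacklundAt_add_smul (ha : 0 < a) {p : M}
    (hfp : MDifferentiableAt 𝓘(ℝ, Plane) 𝓘(ℝ, R3) f p) (hf : IsPotentialAt c n f p) :
    IsBacklundAt a f n (fun q => f q + sinBacklund a • w q) (backlundNormal a n t) p := by
  have ho := h.ortho p
  have ho' := h.isMovingFrame_backlundNormal.ortho p
  have hS : 0 < sinBacklund a := by unfold sinBacklund; positivity
  have hdiff : f p + sinBacklund a • w p - f p = sinBacklund a • w p := add_sub_cancel_left _ _
  have horth : inner ℝ (n p) (f p + sinBacklund a • w p - f p) = (0 : ℝ) := by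
    rw [hdiff, real_inner_smul_right, ho.n_w, mul_zero]
  have horth' : inner ℝ (backlundNormal a n t p) (f p + sinBacklund a • w p - f p) = (0 : ℝ) := by
    rw [hdiff, real_inner_smul_right, ho'.n_w, mul_zero]
  exact
    { orthogonal := horth
      orthogonal' := horth'
      tangent := fun him => him.exists_dmap_eq ho.n_ne_zero hf.inner_dmap horth
      tangent' := fun him => him.exists_dmap_eq ho'.n_ne_zero
        (h.isPotentialAt_add_smul ha.ne' hfp hf).inner_dmap horth'
      distance := by
        rw [dist_eq_norm, hdiff, norm_smul, norm_eq_one_of_inner_self ho.w_w, mul_one,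
          Real.norm_of_nonneg hS.le, sinBacklund_eq ha]
      angle := (h.inner_backlundNormal p).trans (cosBacklund_eq ha) }

end IsBacklundFrame

theorem IsNullLineSubbundle.exists_isBacklundFrame (hL : IsNullLineSubbundle L)
    (hn : IsHarmonic c n) (hpar : IsParallel (covD (assocForm c n (Complex.I * a))) L)
    (hrefl : ∀ p, (L p).map (reflC (n p)) = conjLine (L p))
    (hinf : ∀ p, L p ⊓ conjLine (L p) = ⊥) : ∃ t w Ω, IsBacklundFrame c a n t w Ω ∧
      ∀ p, L p = Submodule.span ℂ {cx (n p) + Complex.I • cx (t p)} := by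
  obtain ⟨t, ht, hframe⟩ := hL.exists_tangent hn.smooth hn.inner_self hrefl hinf
  obtain ⟨Ω, hΩ⟩ := exists_isMovingFrame hn.smooth ht fun p => (hframe p).1
  have hspan (p : M) := (hframe p).2
  exact ⟨t, _, Ω, hΩ.isBacklundFrame hspan hpar, hspan⟩

end Backlund

theorem mainTheorem4 {M : Type*} [TopologicalSpace M] [ChartedSpace Plane M]
    [IsManifold 𝓘(ℝ, Plane) ∞ M] :
    -- gauging an arbitrary holomorphic family of metric connections by `Γ^L_{L'}`
    (∀ (L L' : M → Submodule ℂ C3), IsNullLineSubbundle L → IsNullLineSubbundle L' →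
      (∀ p, L p ⊓ L' p = ⊥) →
      ∀ (A : ℂ → ConnForm M), (∀ z, IsMetricConn (A z)) →
      ∀ (k₁ k₂ k₃ k₄ : ℂ), k₁ * k₄ - k₂ * k₃ ≠ 0 →
      (∀ α : ℂ, k₁ * α + k₂ = 0 →
        (∀ p (X : TangentSpace 𝓘(ℝ, Plane) p), AnalyticAt ℂ (fun z => A z p X) α) →
        (HolomorphicAcross
            (fun z => gaugeAct (fun p => gamma (L p) (L' p) ((k₁ * z + k₂) / (k₃ * z + k₄)))
              (covD (A z))) α ↔
          IsParallel (covD (A α)) L)) ∧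
      (∀ β : ℂ, k₃ * β + k₄ = 0 →
        (∀ p (X : TangentSpace 𝓘(ℝ, Plane) p), AnalyticAt ℂ (fun z => A z p X) β) →
        (HolomorphicAcross
            (fun z => gaugeAct (fun p => gamma (L p) (L' p) ((k₁ * z + k₂) / (k₃ * z + k₄)))
              (covD (A z))) β ↔
          IsParallel (covD (A β)) L'))) ∧
    -- the transform of a harmonic map
    (∀ (c : LorentzConformalStructure M) (N : M → R3), IsHarmonic c N →
      ∀ (a : ℝ), 0 < a →
      ∀ (L : M → Submodule ℂ C3), IsNullLineSubbundle L →
      IsParallel (covD (assocForm c N (Complex.I * a))) L →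
      (∀ p, (L p).map (reflC (N p)) = conjLine (L p)) →
      (∀ p, L p ⊓ conjLine (L p) = ⊥) →
      ∃ N' : M → R3,
        (∀ p, cx (N' p) = dressingInfty L a p (cx (N p))) ∧
        IsHarmonic c N' ∧
        (∀ z : ℂ, z ≠ 0 → IsFlat (assocForm c N' z)) ∧
        (∀ z : ℂ, z ≠ 0 → z ≠ Complex.I * a → z ≠ -(Complex.I * a) →
          ∀ (s : M → C3) (p : M), ContMDiffAt 𝓘(ℝ, Plane) 𝓘(ℝ, C3) ∞ s p →
          ∀ X : TangentSpace 𝓘(ℝ, Plane) p,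
            covD (assocForm c N' z) s p X =
              gaugeAct (dressing L a z) (covD (assocForm c N z)) s p X) ∧
        HolomorphicAcross (fun z => gaugeAct (dressing L a z) (covD (assocForm c N z)))
          (Complex.I * a) ∧
        HolomorphicAcross (fun z => gaugeAct (dressing L a z) (covD (assocForm c N z)))
          (-(Complex.I * a)) ∧
        -- the surfaces, on any open set on which `N × *dN` has a primitive `f`
        (∀ (W : Set M), IsOpen W →
          ∀ (f : M → R3), ContMDiffOn 𝓘(ℝ, Plane) 𝓘(ℝ, R3) ∞ f W →
          (∀ p ∈ W, IsPotentialAt c N f p) →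
          ∃ f' : M → R3,
            ContMDiffOn 𝓘(ℝ, Plane) 𝓘(ℝ, R3) ∞ f' W ∧
            ∀ p ∈ W,
              -- `f' = f - ∂r/∂z|₁`, skew endomorphisms being identified with vectors
              HasDerivAt (fun z => dressing L a z p) (crossEnd (cx (f p - f' p))) 1 ∧
              IsPotentialAt c N' f' p ∧
              IsBacklundAt a f N f' N' p ∧
              (∀ u ∈ L p ⊔ conjLine (L p), cx (f' p - f p) ⬝ᵥ u = 0) ∧
              (ImmersesAt f p → HasGaussMapAndCurvatureAt f N p (-1) ∧
                SecondFormSpansAt c f N p) ∧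
              (ImmersesAt f' p → HasGaussMapAndCurvatureAt f' N' p (-1) ∧
                SecondFormSpansAt c f' N' p) ∧
              (ImmersesAt f p → ImmersesAt f' p → ∀ X : TangentSpace 𝓘(ℝ, Plane) p,
                (secondForm f' N' p X X = 0 ↔ secondForm f N p X X = 0)))) := by
  refine ⟨fun L L' hL hL' hLL' A hA k₁ k₂ k₃ k₄ hdet =>
    ⟨fun α hα han => holomorphicAcross_gaugeAct_gamma_mobius_zero_iff hL hL' hLL' hA hdet hα han,
      fun β hβ han => holomorphicAcross_gaugeAct_gamma_mobius_pole_iff hL hL' hLL' hA hdet hβ han⟩,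
    fun c N hN a ha L hL hpar hrefl hinf => ?_⟩
  obtain ⟨t, w, Ω, h, hspan⟩ := hL.exists_isBacklundFrame hN hpar hrefl hinf
  have hN' := h.isHarmonic_backlundNormal ha.ne' hN
  have hIa : Complex.I * a ≠ 0 := mul_ne_zero Complex.I_ne_zero (Complex.ofReal_ne_zero.2 ha.ne')
  refine ⟨backlundNormal a N t, fun p => (h.dressingInfty_apply hspan p).symm, hN',
    fun z hz => hN'.isFlat_assocForm hz,
    fun z hz hz₁ hz₂ s p hs X => (h.gaugeAct_dressing_covD ha.ne' hz hz₁ hz₂ hspan hs X).symm,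
    h.holomorphicAcross_gaugeAct_dressing ha.ne' hspan hIa,
    h.holomorphicAcross_gaugeAct_dressing ha.ne' hspan (neg_ne_zero.2 hIa),
    fun W hW f hfs hf => ⟨fun p => f p + sinBacklund a • w p, fun p hp => (hfs p hp).add
      (contMDiffAt_clm (sinBacklund a • ContinuousLinearMap.id ℝ R3)
        (h.smooth_w p)).contMDiffWithinAt,
      fun p hp => ?_⟩⟩
  have hfp := (hfs.contMDiffAt (hW.mem_nhds hp)).mdifferentiableAt (by simp)
  have hf' := h.isPotentialAt_add_smul ha.ne' hfp (hf p hp)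
  have hsurf := hN.hasGaussMapAndCurvatureAt_and_secondFormSpansAt (hf p hp)
  have hsurf' := hN'.hasGaussMapAndCurvatureAt_and_secondFormSpansAt hf'
  refine ⟨?_, hf', h.isBacklundAt_add_smul ha hfp (hf p hp), fun u hu => ?_, hsurf, hsurf',
    fun him him' X => (hsurf him).2.secondForm_self_eq_zero_iff (hsurf' him').2 X⟩
  · rw [sub_add_cancel_left, ← neg_smul]
    exact h.hasDerivAt_dressing p hspan a
  · rw [add_sub_cancel_left, cx_smul, smul_dotProduct, h.cx_dotProduct_eq_zero p hspan hu,
      smul_zero]
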